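/- Let $G$ be a locally compact (Hausdorff) group with left Haar measure $ds$, and let $\mathcal{E}$ be a class of complex Banach spaces. **Representations.** A continuous isometric representation $(\pi,E)$ of $G$ is a homomorphism $\pi$ from $G$ to the group of surjective linear isometries of a Banach space $E$ such that $s\mapsto\pi(s)\xi$ is continuous for every $\xi\in E$. For $f\in L^1(G)$ put $\pi(f)\xi=\int_G f(s)\pi(s)\xi\,ds$. Let $\mathrm{Rep}_{\mathcal{E}}(G)$ be the class of continuous isometric representations of $G$ on spaces in $\mathcal{E}$, and let $\mathrm{Rep}_{\mathcal{E}}(G)^*$ be the smallest class of continuous isometric representations of $G$ that contains $\mathrm{Rep}_{\mathcal{E}}(G)$ and contains, with each $(\pi,E)$, the dual representation $(\pi^*,E^*)$, $(\pi^*(t)\eta)(x)=\eta(\pi(t^{-1})x)$, whenever $\pi^*$ is again (strongly) continuous. Let $F^*_{\mathcal{E}}(G)$ be the Banach algebra obtained from the convolution algebra $L^1(G)$ by (Hausdorff) completion with respect to the seminorm $\|f\|=\sup\{\|\pi(f)\| : \pi\in \mathrm{Rep}_{\mathcal{E}}(G)^*\}$. **Weak property $(\mathrm{T}_{\mathcal{E}})$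 for $G$.** $G$ has weak property $(\mathrm{T}_{\mathcal{E}})$ if every continuous isometric representation $(\pi,E)$ of $G$ with $E\in\mathcal{E}$ which admits a net of unit vectors $(\xi_i)$ with $\sup_{s\in K}\|\pi(s)\xi_i-\xi_i\|\to0$ for each compact $K\subset G$ has a non-zero $G$-invariant vector. **Weak property $(\mathrm{T}_{\mathcal{E}})$ for a Banach algebra.** Let $\mathcal{A}$ be a Banach algebra with a bounded (two-sided) approximate unit. An $\mathcal{A}$-bimodule is a Banach space $E$ with commuting contractive representations of $\mathcal{A}$ and of $\mathcal{A}^{\mathrm{op}}$ on $E$; it is essential if the span of $\mathcal{A}\cdot E\cdot\mathcal{A}$ is dense in $E$. The multiplier algebra $\mathrm{M}(\mathcal{A})$ consists of the pairs $x=(L,R)$ of bounded linear maps $\mathcal{A}\to\mathcal{A}$ with $aL(b)=R(a)b$ for all $a,b\in\mathcal{A}$; its strict topology is generated by the seminorms $(L,R)\mapsto\|L(a)\|+\|R(a)\|$, $a\in\mathcal{A}$. The actions on an essential bimodule extend uniquely to $\mathrm{M}(\mathcal{A})$ by bounded operators with $x\cdot(a\cdot\xi)=L(a)\cdot\xi$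 and $(\xi\cdot a)\cdot x=\xi\cdot R(a)$. A net $(\xi_i)$ in $E$ is strictly almost $\mathcal{A}$-central if $\sup_{x\in S}\|x\cdot\xi_i-\xi_i\cdot x\|\to0$ for each strictly compact $S\subset\mathrm{M}(\mathcal{A})$, and $\xi\in E$ is central if $a\cdot\xi=\xi\cdot a$ for all $a\in\mathcal{A}$. $\mathcal{A}$ has weak property $(\mathrm{T}_{\mathcal{E}})$ if every essential $\mathcal{A}$-bimodule $E\in\mathcal{E}$ which admits a strictly almost $\mathcal{A}$-central net of unit vectors contains a non-zero central vector. **Theorem.** The following are equivalent: (i) $G$ has weak property $(\mathrm{T}_{\mathcal{E}})$; (ii) $F^*_{\mathcal{E}}(G)$ has a bounded approximate unit and has weak property $(\mathrm{T}_{\mathcal{E}})$. -/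

import Mathlib

universe u v w

noncomputable section

set_option linter.unusedSectionVars false

open MeasureTheory Filter Topology
open scoped ENNReal MultiplierAlgebra Pointwise

namespace BanachT

/-! ### Classes of Banach spaces and isometric representations -/

/-- A complex Banach space. A class of Banach spaces is a `Set BanachSp`. -/
structure BanachSp : Type (u + 1) where
  carrier : Type u
  [normedAddCommGroup : NormedAddCommGroup carrier]
  [normedSpace : NormedSpace ℂ carrier]
  [completeSpace : CompleteSpace carrier]

instance : CoeSort BanachSp.{u} (Type u) := ⟨BanachSp.carrier⟩

attribute [instance] BanachSp.normedAddCommGroup BanachSp.normedSpace BanachSp.completeSpace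

/-- The dual Banach space. -/
def BanachSp.dual (E : BanachSp.{u}) : BanachSp.{u} := ⟨StrongDual ℂ E⟩

/-- A (strongly) continuous isometric representation of `G` on the Banach space `E`. -/
structure IsomRep (G : Type v) [Group G] [TopologicalSpace G] (E : BanachSp.{u}) where
  toHom : G →* (E ≃ₗᵢ[ℂ] E)
  continuous_orbit : ∀ ξ : E, Continuous fun s => toHom s ξ

section Group

variable {G : Type v} [Group G] [TopologicalSpace G]

namespace IsomRep

variable {E : BanachSp.{u}} (π : IsomRep G E)

/-- A vector fixed by the whole group. -/
def IsInvariant (ξ : E) : Prop := ∀ s, π.toHom s ξ = ξ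

/-- A net of almost invariant vectors: `sup_{s ∈ K} ‖π(s)ξᵢ - ξᵢ‖ → 0` for each compact `K`. -/
def IsAlmostInvariant {I : Type w} [Preorder I] (ξ : I → E) : Prop :=
  ∀ K : Set G, IsCompact K → ∀ ε : ℝ, 0 < ε →
    ∃ i₀, ∀ i, i₀ ≤ i → ∀ s ∈ K, ‖π.toHom s (ξ i) - ξ i‖ < ε

/-- The operator `π*(t)` on the dual space: `(π*(t) η)(x) = η (π(t⁻¹) x)`. -/
def dualOp (t : G) : E.dual ≃ₗᵢ[ℂ] E.dual where
  toFun η := (show StrongDual ℂ E from η).comp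
    ((π.toHom t⁻¹).toContinuousLinearEquiv : E →L[ℂ] E)
  invFun η := (show StrongDual ℂ E from η).comp
    ((π.toHom t).toContinuousLinearEquiv : E →L[ℂ] E)
  map_add' _ _ := rfl
  map_smul' _ _ := rfl
  left_inv η := by
    refine ContinuousLinearMap.ext fun x => ?_
    change (show StrongDual ℂ E from η) (π.toHom t⁻¹ (π.toHom t x)) =
      (show StrongDual ℂ E from η) x
    rw [map_inv]
    exact congrArg (show StrongDual ℂ E from η) ((π.toHom t).symm_apply_apply x)
  right_inv η := by
    refine ContinuousLinearMap.ext fun x => ?_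
    change (show StrongDual ℂ E from η) (π.toHom t (π.toHom t⁻¹ x)) =
      (show StrongDual ℂ E from η) x
    rw [map_inv]
    exact congrArg (show StrongDual ℂ E from η) ((π.toHom t).apply_symm_apply x)
  norm_map' η := ContinuousLinearMap.opNorm_comp_linearIsometryEquiv
    (show StrongDual ℂ E from η) (π.toHom t⁻¹)

theorem dualOp_apply (t : G) (η : E.dual) (x : E) :
    (show StrongDual ℂ E from π.dualOp t η) x
      = (show StrongDual ℂ E from η) (π.toHom t⁻¹ x) := rfl

/-- The dual representation is strongly continuous (automatic for reflexive `E` and for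
discrete `G`, not in general). -/
def DualContinuous : Prop := ∀ η : E.dual, Continuous fun t => π.dualOp t η

/-- The dual representation `π*` on the dual Banach space. -/
def dual (h : π.DualContinuous) : IsomRep G E.dual where
  toHom :=
    { toFun := π.dualOp
      map_one' := by
        refine LinearIsometryEquiv.ext fun η => ContinuousLinearMap.ext fun x => ?_
        change (show StrongDual ℂ E from η) (π.toHom 1⁻¹ x) =
          (show StrongDual ℂ E from η) x
        simp
      map_mul' := fun s t => by
        refine LinearIsometryEquiv.ext fun η => ContinuousLinearMap.ext fun x => ?_
        change (show StrongDual ℂ E from η) (π.toHom (s * t)⁻¹ x) =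
          (show StrongDual ℂ E from η) (π.toHom t⁻¹ (π.toHom s⁻¹ x))
        rw [mul_inv_rev, map_mul]
        rfl }
  continuous_orbit := h

end IsomRep

/-- The class `Rep_𝓔(G)` of all continuous isometric representations of `G` on spaces in `𝓔`. -/
def RepClass (𝓔 : Set BanachSp.{u}) (E : BanachSp.{u}) (_ : IsomRep G E) : Prop := E ∈ 𝓔

/-- The class `R*`: the smallest class of continuous isometric representations that contains `R`
and is closed under duality. (A dual representation which fails to be strongly continuous is
not a continuous isometric representation, and is not adjoined.) -/
inductive DualClosure (R : ∀ E : BanachSp.{u}, IsomRep G E → Prop) :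
    ∀ E : BanachSp.{u}, IsomRep G E → Prop
  | of {E : BanachSp.{u}} {π : IsomRep G E} : R E π → DualClosure R E π
  | dual {E : BanachSp.{u}} {π : IsomRep G E} (h : π.DualContinuous) :
      DualClosure R E π → DualClosure R E.dual (π.dual h)

/-- Weak property `(T_𝓔)` for the group `G`. -/
def GroupWeakPropertyT (G : Type v) [Group G] [TopologicalSpace G] (𝓔 : Set BanachSp.{u}) :
    Prop :=
  ∀ E ∈ 𝓔, ∀ π : IsomRep G E,
    (∃ (I : Type v) (_ : Preorder I) (_ : IsDirectedOrder I) (_ : Nonempty I) (ξ : I → E),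
      (∀ i, ‖ξ i‖ = 1) ∧ π.IsAlmostInvariant ξ) →
    ∃ ξ : E, ξ ≠ 0 ∧ π.IsInvariant ξ

end Group

/-! ### Integrated forms -/

section Integrated

variable (G : Type v) [Group G] [TopologicalSpace G] [IsTopologicalGroup G]
  [LocallyCompactSpace G] [MeasurableSpace G] [BorelSpace G]

/-- `L¹(G)` with respect to (left) Haar measure. -/
abbrev L1 : Type v := Lp ℂ 1 (Measure.haar : Measure G)

variable {G}

/-- `f` is (the class of) a continuous function with compact support. -/
def IsCc (f : L1 G) : Prop :=
  ∃ g : G → ℂ, Continuous g ∧ HasCompactSupport g ∧ f =ᵐ[Measure.haar] g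

theorem exists_hasCompactSupport_eLpNorm_sub_le [T2Space G] {f : G → ℂ}
    (hf : MemLp f 1 (Measure.haar : Measure G)) {ε : ℝ≥0∞} (hε : ε ≠ 0) :
    ∃ g : G → ℂ, HasCompactSupport g ∧ eLpNorm (f - g) 1 Measure.haar ≤ ε ∧ Continuous g ∧
      MemLp g 1 (Measure.haar : Measure G) := by
  let μ : Measure G := Measure.haar
  suffices H : ∃ g : G → ℂ, eLpNorm (f - g) 1 μ ≤ ε ∧
      (Continuous g ∧ MemLp g 1 μ ∧ HasCompactSupport g) by
    rcases H with ⟨g, hg, g_cont, g_mem, g_support⟩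
    exact ⟨g, g_support, hg, g_cont, g_mem⟩
  refine hf.induction_dense ENNReal.one_ne_top
    (fun g => Continuous g ∧ MemLp g 1 μ ∧ HasCompactSupport g) ?_ ?_ ?_ hε
  rotate_left
  · rintro f g ⟨f_cont, f_mem, hf⟩ ⟨g_cont, g_mem, hg⟩
    exact ⟨f_cont.add g_cont, f_mem.add g_mem, hf.add hg⟩
  · rintro f ⟨_, f_mem, _⟩
    exact f_mem.aestronglyMeasurable
  intro c t ht htμ ε hε
  rcases exists_Lp_half ℂ μ 1 hε with ⟨δ, δpos, hδ⟩
  obtain ⟨η, ηpos, hη⟩ : ∃ η : NNReal, 0 < η ∧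
      ∀ s : Set G, μ s ≤ η → eLpNorm (s.indicator fun _ => c) 1 μ ≤ δ :=
    exists_eLpNorm_indicator_le ENNReal.one_ne_top c δpos.ne'
  have hη_pos' : (η : ℝ≥0∞) ≠ 0 := (ENNReal.coe_pos.2 ηpos).ne'
  obtain ⟨s, st, s_compact, s_closed, μs⟩ :
      ∃ s, s ⊆ t ∧ IsCompact s ∧ IsClosed s ∧ μ (t \ s) < η :=
    ht.exists_isCompact_isClosed_sdiff_lt htμ.ne hη_pos'
  have hsμ : μ s < ∞ := (measure_mono st).trans_lt htμ
  have I1 : eLpNorm ((s.indicator fun _ => c) - t.indicator fun _ => c) 1 μ ≤ δ := by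
    rw [← eLpNorm_neg, neg_sub, ← Set.indicator_sdiff st]
    exact hη _ μs.le
  obtain ⟨V, sV, V_open, -, hV⟩ : ∃ (V : Set G), V ⊇ s ∧ IsOpen V ∧ μ V < ∞ ∧ μ (V \ s) < η :=
    s_closed.measurableSet.exists_isOpen_sdiff_lt hsμ.ne hη_pos'
  obtain ⟨g, hgs, hgV, hgc, hg_range⟩ := exists_continuous_one_zero_of_isCompact s_compact
    V_open.isClosed_compl (Set.disjoint_compl_right_iff_subset.2 sV)
  have hcont : Continuous fun x => (g x : ℂ) * c := by fun_prop
  have hsupp : HasCompactSupport fun x => (g x : ℂ) * c := by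
    refine hgc.mono fun x hx => ?_
    simp only [Function.mem_support, ne_eq, mul_eq_zero, not_or] at hx ⊢
    exact_mod_cast hx.1
  have hmem : MemLp (fun x => (g x : ℂ) * c) 1 μ :=
    memLp_one_iff_integrable.2 (hcont.integrable_of_hasCompactSupport hsupp)
  have I2 : eLpNorm ((fun x => (g x : ℂ) * c) - s.indicator fun _ => c) 1 μ ≤ δ := by
    refine (eLpNorm_mono (g := (V \ s).indicator fun _ => c) fun x => ?_).trans (hη _ hV.le)
    by_cases hxs : x ∈ s
    · have : g x = 1 := hgs hxs
      simp [hxs, this]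
    · by_cases hxV : x ∈ V
      · have h0 := (hg_range x).1
        have h1 := (hg_range x).2
        simpa [hxs, hxV, abs_of_nonneg h0] using
          mul_le_of_le_one_left (norm_nonneg c) h1
      · have : g x = 0 := hgV hxV
        simp [hxs, hxV, this]
  refine ⟨_, ?_, hcont, hmem, hsupp⟩
  have := (hδ _ _ (hmem.aestronglyMeasurable.sub
    (aestronglyMeasurable_const.indicator s_closed.measurableSet))
    ((aestronglyMeasurable_const.indicator s_closed.measurableSet).sub
      (aestronglyMeasurable_const.indicator ht)) I2 I1).le
  rwa [sub_add_sub_cancel] at this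

theorem exists_isCc_near [T2Space G] (f : L1 G) {ε : ℝ} (hε : 0 < ε) :
    ∃ h : L1 G, IsCc h ∧ ‖f - h‖ ≤ ε := by
  obtain ⟨g, hgs, hfg, hgc, hg⟩ := exists_hasCompactSupport_eLpNorm_sub_le
    (Lp.memLp f) (ε := ENNReal.ofReal ε) (by simpa using hε)
  refine ⟨hg.toLp g, ⟨g, hgc, hgs, hg.coeFn_toLp⟩, ?_⟩
  rw [Lp.norm_def]
  refine ENNReal.toReal_le_of_le_ofReal hε.le (le_trans (le_of_eq ?_) hfg)
  refine eLpNorm_congr_ae ?_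
  filter_upwards [Lp.coeFn_sub f (hg.toLp g), hg.coeFn_toLp] with x hx hx'
  rw [hx, Pi.sub_apply, Pi.sub_apply, hx']

variable {E : BanachSp.{u}} (π : IsomRep G E)

theorem continuous_smul_orbit {g : G → ℂ} (hg : Continuous g) (ξ : E) :
    Continuous fun s => g s • π.toHom s ξ := hg.smul (π.continuous_orbit ξ)

theorem aestronglyMeasurable_integrand [T2Space G] (f : L1 G) (ξ : E) :
    AEStronglyMeasurable (fun s => f s • π.toHom s ξ) Measure.haar := by
  have H : ∀ n : ℕ, ∃ h : L1 G, IsCc h ∧ ‖f - h‖ ≤ 1 / ((n : ℝ) + 1) := fun n =>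
    exists_isCc_near f (by positivity)
  choose h hc hn using H
  have hlim : Tendsto h atTop (𝓝 f) := by
    rw [tendsto_iff_norm_sub_tendsto_zero]
    refine squeeze_zero (fun _ => norm_nonneg _) (fun n => ?_)
      tendsto_one_div_add_atTop_nhds_zero_nat
    rw [norm_sub_rev]
    exact hn n
  obtain ⟨ns, -, hns⟩ := (tendstoInMeasure_of_tendsto_Lp hlim).exists_seq_tendsto_ae
  refine aestronglyMeasurable_of_tendsto_ae atTop
    (f := fun n s => h (ns n) s • π.toHom s ξ) (fun n => ?_) ?_
  · obtain ⟨g, hg, hgs, hae⟩ := hc (ns n)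
    have : Integrable (fun s => g s • π.toHom s ξ) Measure.haar :=
      (continuous_smul_orbit π hg ξ).integrable_of_hasCompactSupport hgs.smul_right
    refine this.aestronglyMeasurable.congr ?_
    filter_upwards [hae] with s hs
    rw [hs]
  · filter_upwards [hns] with s hs
    exact hs.smul_const _

theorem integrable_integrand [T2Space G] (f : L1 G) (ξ : E) :
    Integrable (fun s => f s • π.toHom s ξ) Measure.haar := by
  refine ((L1.integrable_coeFn f).norm.mul_const ‖ξ‖).mono'
    (aestronglyMeasurable_integrand π f ξ) (Eventually.of_forall fun s => ?_)
  simp [norm_smul]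

theorem norm_integral_integrand_le [T2Space G] (f : L1 G) (ξ : E) :
    ‖∫ s, f s • π.toHom s ξ ∂Measure.haar‖ ≤ ‖f‖ * ‖ξ‖ := by
  refine (norm_integral_le_integral_norm _).trans (le_of_eq ?_)
  simp [norm_smul, integral_mul_const, L1.norm_eq_integral_norm]

/-- The integrated form `π(f) ξ = ∫ f(s) π(s) ξ ds` of `π`, for `f ∈ L¹(G)`. -/
def integrated [T2Space G] (f : L1 G) : E →L[ℂ] E :=
  LinearMap.mkContinuous
    { toFun := fun ξ => ∫ s, f s • π.toHom s ξ ∂Measure.haar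
      map_add' := fun ξ η => by
        simp only [map_add, smul_add]
        exact integral_add (integrable_integrand π f ξ) (integrable_integrand π f η)
      map_smul' := fun c ξ => by
        simp only [map_smul, RingHom.id_apply]
        rw [← integral_smul]
        exact integral_congr_ae (Eventually.of_forall fun s => smul_comm _ _ _) }
    ‖f‖ (norm_integral_integrand_le π f)

variable [T2Space G]

theorem integrated_apply (f : L1 G) (ξ : E) :
    integrated π f ξ = ∫ s, f s • π.toHom s ξ ∂Measure.haar := rfl

theorem norm_integrated_le (f : L1 G) : ‖integrated π f‖ ≤ ‖f‖ :=
  LinearMap.mkContinuous_norm_le _ (norm_nonneg _) _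

theorem integrated_add (f g : L1 G) :
    integrated π (f + g) = integrated π f + integrated π g := by
  ext ξ
  simp only [integrated_apply, add_apply]
  rw [← integral_add (integrable_integrand π f ξ) (integrable_integrand π g ξ)]
  refine integral_congr_ae ?_
  filter_upwards [Lp.coeFn_add f g] with s hs
  rw [hs, Pi.add_apply, add_smul]

theorem integrated_smul (c : ℂ) (f : L1 G) :
    integrated π (c • f) = c • integrated π f := by
  ext ξ
  simp only [integrated_apply, smul_apply]
  rw [← integral_smul]
  refine integral_congr_ae ?_
  filter_upwards [Lp.coeFn_smul c f] with s hs
  rw [hs, Pi.smul_apply, smul_eq_mul, mul_smul]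

/-- The convolution `(f * g)(x) = ∫ f(s) g(s⁻¹x) ds` of two functions. -/
def conv (f g : G → ℂ) (x : G) : ℂ := ∫ s, f s * g (s⁻¹ * x) ∂Measure.haar

theorem conv_continuous {f g : G → ℂ} (hf : Continuous f) (hfs : HasCompactSupport f)
    (hg : Continuous g) : Continuous (conv f g) := by
  rw [← continuousOn_univ]
  refine continuousOn_integral_of_compact_support (k := tsupport f) hfs
    (f := fun x s => f s * g (s⁻¹ * x)) ?_ ?_
  · refine Continuous.continuousOn ?_
    exact (hf.comp continuous_snd).mul (hg.comp (continuous_snd.inv.mul continuous_fst))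
  · intro x s _ hs
    simp [image_eq_zero_of_notMem_tsupport hs]

theorem conv_integrand_support {f g : G → ℂ} (hfs : HasCompactSupport f)
    (hgs : HasCompactSupport g) :
    ∃ L : Set G, IsCompact L ∧ ∀ x, x ∉ L → ∀ s, f s * g (s⁻¹ * x) = 0 := by
  refine ⟨tsupport f * tsupport g, IsCompact.mul hfs hgs, fun x hx s => ?_⟩
  by_contra h
  refine hx ⟨s, subset_tsupport f (left_ne_zero_of_mul h), s⁻¹ * x,
    subset_tsupport g (right_ne_zero_of_mul h), by simp⟩

theorem conv_hasCompactSupport {f g : G → ℂ} (hfs : HasCompactSupport f)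
    (hgs : HasCompactSupport g) : HasCompactSupport (conv f g) := by
  obtain ⟨L, hL, h⟩ := conv_integrand_support hfs hgs
  exact HasCompactSupport.intro hL fun x hx => by simp [conv, h x hx]

theorem integrated_of_ae {f : L1 G} {g : G → ℂ} (h : f =ᵐ[Measure.haar] g) (ξ : E) :
    integrated π f ξ = ∫ s, g s • π.toHom s ξ ∂Measure.haar := by
  rw [integrated_apply]
  refine integral_congr_ae ?_
  filter_upwards [h] with s hs
  rw [hs]

/-- The integrated form turns convolution into composition. -/
theorem integrated_conv {F H K : L1 G} {f h : G → ℂ} (hf : Continuous f)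
    (hfs : HasCompactSupport f) (hh : Continuous h) (hhs : HasCompactSupport h)
    (hF : F =ᵐ[Measure.haar] f) (hH : H =ᵐ[Measure.haar] h)
    (hK : K =ᵐ[Measure.haar] conv f h) :
    integrated π K = integrated π F * integrated π H := by
  ext ξ
  change _ = integrated π F (integrated π H ξ)
  rw [integrated_of_ae π hK, integrated_of_ae π hF,
    integrated_of_ae π hH]
  obtain ⟨L, hL, hz⟩ := conv_integrand_support hfs hhs
  have step1 : ∀ s, f s • π.toHom s (∫ t, h t • π.toHom t ξ ∂Measure.haar)
      = ∫ x, (f s * h (s⁻¹ * x)) • π.toHom x ξ ∂Measure.haar := by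
    intro s
    have e : π.toHom s (∫ t, h t • π.toHom t ξ ∂Measure.haar)
        = ∫ t, h t • π.toHom (s * t) ξ ∂Measure.haar := by
      have := ((π.toHom s).toContinuousLinearEquiv : E →L[ℂ] E).integral_comp_comm
        ((continuous_smul_orbit π hh ξ).integrable_of_hasCompactSupport
          (μ := Measure.haar) hhs.smul_right)
      refine this.symm.trans (integral_congr_ae (Eventually.of_forall fun t => ?_))
      simp [map_mul]
    rw [e, ← integral_mul_left_eq_self (fun x => (f s * h (s⁻¹ * x)) • π.toHom x ξ) s,
      ← integral_smul]
    refine integral_congr_ae (Eventually.of_forall fun t => ?_)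
    simp [mul_smul]
  simp only [step1]
  rw [← integral_integral_swap_of_hasCompactSupport
    (f := fun x s => (f s * h (s⁻¹ * x)) • π.toHom x ξ)]
  · refine integral_congr_ae (Eventually.of_forall fun x => ?_)
    exact (integral_smul_const _ _).symm
  · exact ((hf.comp continuous_snd).mul
      (hh.comp (continuous_snd.inv.mul continuous_fst))).smul
        ((π.continuous_orbit ξ).comp continuous_fst)
  · refine HasCompactSupport.intro (hL.prod hfs) ?_
    rintro ⟨x, s⟩ hx
    change (f s * h (s⁻¹ * x)) • π.toHom x ξ = 0
    rw [Set.mem_prod, not_and_or] at hx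
    rcases hx with hx | hx
    · rw [hz x hx s, zero_smul]
    · rw [image_eq_zero_of_notMem_tsupport hx, zero_mul, zero_smul]

/-! ### The symmetrized pseudofunction algebra -/

variable (R : ∀ E : BanachSp.{u}, IsomRep G E → Prop)

/-- The members of the class `R*`. -/
def Idx : Type max v (u + 1) :=
  { p : Σ E : BanachSp.{u}, IsomRep G E // DualClosure R p.1 p.2 }

/-- The Banach algebra of norm bounded families of operators `(T_π)_{π ∈ R*}`, `T_π ∈ 𝓑(E_π)`,
with the supremum norm. -/
def Ops : Type max v (u + 1) :=
  lp (fun p : Idx R => (p.1.1 →L[ℂ] p.1.1)) ∞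

instance : NonUnitalNormedRing (Ops R) :=
  inferInstanceAs (NonUnitalNormedRing (lp (fun p : Idx R => (p.1.1 →L[ℂ] p.1.1)) ∞))

instance : NormedSpace ℂ (Ops R) :=
  inferInstanceAs (NormedSpace ℂ (lp (fun p : Idx R => (p.1.1 →L[ℂ] p.1.1)) ∞))

instance : IsScalarTower ℂ (Ops R) (Ops R) :=
  inferInstanceAs (IsScalarTower ℂ (lp (fun p : Idx R => (p.1.1 →L[ℂ] p.1.1)) ∞)
    (lp (fun p : Idx R => (p.1.1 →L[ℂ] p.1.1)) ∞))

instance : SMulCommClass ℂ (Ops R) (Ops R) :=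
  inferInstanceAs (SMulCommClass ℂ (lp (fun p : Idx R => (p.1.1 →L[ℂ] p.1.1)) ∞)
    (lp (fun p : Idx R => (p.1.1 →L[ℂ] p.1.1)) ∞))

instance : CompleteSpace (Ops R) :=
  inferInstanceAs (CompleteSpace (lp (fun p : Idx R => (p.1.1 →L[ℂ] p.1.1)) ∞))

/-- The homomorphism `L¹(G) → ∏_{π ∈ R*} 𝓑(E_π)`, `f ↦ (π(f))_π`. -/
def toOps : L1 G →ₗ[ℂ] Ops R where
  toFun f := (⟨fun p => integrated p.1.2 f, memℓp_infty ⟨‖f‖, by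
    rintro _ ⟨p, rfl⟩
    exact norm_integrated_le p.1.2 f⟩⟩ : lp (fun p : Idx R => (p.1.1 →L[ℂ] p.1.1)) ∞)
  map_add' f g := lp.ext (funext fun p => integrated_add p.1.2 f g)
  map_smul' c f := lp.ext (funext fun p => integrated_smul p.1.2 c f)

/-- `‖f‖ = sup {‖π(f)‖ : π ∈ R*}`. -/
theorem norm_toOps (f : L1 G) :
    ‖toOps R f‖ = sSup {r : ℝ | ∃ (E : BanachSp.{u}) (π : IsomRep G E),
      DualClosure R E π ∧ r = ‖integrated π f‖} := by
  refine (lp.norm_eq_ciSup (E := fun p : Idx R => (p.1.1 →L[ℂ] p.1.1)) (toOps R f)).trans ?_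
  refine congrArg sSup (Set.ext fun r => ?_)
  constructor
  · rintro ⟨p, rfl⟩
    exact ⟨p.1.1, p.1.2, p.2, rfl⟩
  · rintro ⟨E, π, h, rfl⟩
    exact ⟨⟨⟨E, π⟩, h⟩, rfl⟩

theorem norm_toOps_le (f : L1 G) : ‖toOps R f‖ ≤ ‖f‖ :=
  lp.norm_le_of_forall_le (norm_nonneg f) fun p : Idx R => norm_integrated_le p.1.2 f

theorem mem_closure_toOps_Cc (f : L1 G) :
    toOps R f ∈ closure (toOps R '' {h | IsCc h}) := by
  rw [Metric.mem_closure_iff]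
  intro ε hε
  obtain ⟨h, hc, hn⟩ := exists_isCc_near f (half_pos hε)
  refine ⟨_, ⟨h, hc, rfl⟩, ?_⟩
  rw [dist_eq_norm, ← map_sub]
  exact ((norm_toOps_le R _).trans hn).trans_lt (half_lt_self hε)

theorem mul_mem_closure_range {x y : Ops R} (hx : x ∈ closure (Set.range (toOps R)))
    (hy : y ∈ closure (Set.range (toOps R))) : x * y ∈ closure (Set.range (toOps R)) := by
  have key : closure (Set.range (toOps R)) ⊆ closure (toOps R '' {h | IsCc h}) :=
    closure_minimal (by rintro _ ⟨f, rfl⟩; exact mem_closure_toOps_Cc R f) isClosed_closure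
  refine map_mem_closure₂ continuous_mul (key hx) (key hy) ?_
  rintro _ ⟨F, ⟨f, hf, hfs, hF⟩, rfl⟩ _ ⟨H, ⟨h, hh, hhs, hH⟩, rfl⟩
  have hm : MemLp (conv f h) 1 (Measure.haar : Measure G) := memLp_one_iff_integrable.2
    ((conv_continuous hf hfs hh).integrable_of_hasCompactSupport (conv_hasCompactSupport hfs hhs))
  refine ⟨hm.toLp _, lp.ext (funext fun p => ?_)⟩
  exact integrated_conv p.1.2 hf hfs hh hhs hF hH hm.coeFn_toLp

/-- The closure of `{(π(f))_π : f ∈ L¹(G)}` as a subalgebra. -/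
def symPFSubalgebra : NonUnitalSubalgebra ℂ (Ops R) where
  carrier := closure (Set.range (toOps R))
  zero_mem' := subset_closure ⟨0, map_zero _⟩
  add_mem' {_ _} hx hy := map_mem_closure₂ continuous_add hx hy (by
    rintro _ ⟨f, rfl⟩ _ ⟨g, rfl⟩
    exact ⟨f + g, map_add _ _ _⟩)
  mul_mem' hx hy := mul_mem_closure_range R hx hy
  smul_mem' c {_} hx := map_mem_closure (continuous_const_smul c) hx (by
    rintro _ ⟨f, rfl⟩
    exact ⟨c • f, map_smul _ _ _⟩)

/-- The symmetrized Banach algebra of `R`-pseudofunctions `F*_R(G)`: the (Hausdorff) completion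
of the convolution algebra `L¹(G)` for the seminorm `f ↦ sup {‖π(f)‖ : π ∈ R*}`, realized as the
closure of the isometric image of `L¹(G)` in the Banach algebra `Ops R`
(see `norm_toOps` and `integrated_conv`). -/
def SymPF : Type max v (u + 1) := symPFSubalgebra R

instance : NonUnitalNormedRing (SymPF R) :=
  inferInstanceAs (NonUnitalNormedRing (symPFSubalgebra R))

instance : Module ℂ (SymPF R) := inferInstanceAs (Module ℂ (symPFSubalgebra R))

instance : NormedSpace ℂ (SymPF R) where
  norm_smul_le c x := norm_smul_le c (x.1 : Ops R)

instance : IsScalarTower ℂ (SymPF R) (SymPF R) :=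
  inferInstanceAs (IsScalarTower ℂ (symPFSubalgebra R) (symPFSubalgebra R))

instance : SMulCommClass ℂ (SymPF R) (SymPF R) :=
  inferInstanceAs (SMulCommClass ℂ (symPFSubalgebra R) (symPFSubalgebra R))

instance : CompleteSpace (SymPF R) :=
  (isClosed_closure (s := Set.range (toOps R))).completeSpace_coe

/-- `F*_𝓔(G)`, the symmetrized algebra for the class of all continuous isometric
representations of `G` on spaces in `𝓔`. -/
abbrev SymPseudofunctions (G : Type v) [Group G] [TopologicalSpace G] [IsTopologicalGroup G]
    [LocallyCompactSpace G] [MeasurableSpace G] [BorelSpace G] [T2Space G]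
    (𝓔 : Set BanachSp.{u}) : Type max v (u + 1) :=
  SymPF (RepClass (G := G) 𝓔)

end Integrated

/-! ### Banach algebras: bimodules, multipliers, weak property `(T_𝓔)` -/

section Algebra

variable (A : Type w) [NonUnitalNormedRing A] [NormedSpace ℂ A] [IsScalarTower ℂ A A]
  [SMulCommClass ℂ A A]

/-- `A` has a bounded (two-sided) approximate unit. -/
def HasBoundedApproximateUnit : Prop :=
  ∃ l : Filter A, l.IsApproximateUnit ∧ ∃ C : ℝ, ∀ᶠ e in l, ‖e‖ ≤ C

/-- The strict topology on the multiplier algebra: the one generated by the seminorms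
`(L, R) ↦ ‖L a‖ + ‖R a‖`, `a ∈ A`. -/
@[reducible]
def strictTopology : TopologicalSpace 𝓜(ℂ, A) :=
  TopologicalSpace.induced (fun x (a : A) => (x.fst a, x.snd a)) inferInstance

/-- An `A`-bimodule structure on the Banach space `E`: commuting contractive representations
of `A` and of its opposite algebra on `E`. -/
structure Bimodule (E : BanachSp.{u}) where
  left : A →ₙₐ[ℂ] (E →L[ℂ] E)
  right : Aᵐᵒᵖ →ₙₐ[ℂ] (E →L[ℂ] E)
  norm_left_le : ∀ a, ‖left a‖ ≤ ‖a‖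
  norm_right_le : ∀ b, ‖right b‖ ≤ ‖b‖
  commute : ∀ a b, Commute (left a) (right b)

namespace Bimodule

variable {A} {E : BanachSp.{u}} (M : Bimodule A E)

/-- The span of `A · E · A` is dense in `E`. -/
def IsEssential : Prop :=
  Dense (Submodule.span ℂ
    {ζ : E | ∃ (a b : A) (ξ : E), ζ = M.right (MulOpposite.op b) (M.left a ξ)} : Set E)

/-- `a · ξ = ξ · a` for all `a ∈ A`. -/
def IsCentral (ξ : E) : Prop := ∀ a : A, M.left a ξ = M.right (MulOpposite.op a) ξ

open Classical in
/-- The extended left action `ξ ↦ x · ξ` of a multiplier `x = (L, R)`: the bounded operator with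
`x · (a · ξ) = L(a) · ξ`. For an essential bimodule over an algebra with a bounded approximate
unit it exists (`multLeft_apply`) and is unique (`eq_multLeft`). -/
def multLeft (x : 𝓜(ℂ, A)) : E →L[ℂ] E :=
  if h : ∃ T : E →L[ℂ] E, ∀ (a : A) (ξ : E), T (M.left a ξ) = M.left (x.fst a) ξ
  then h.choose else 0

open Classical in
/-- The extended right action `ξ ↦ ξ · x` of a multiplier `x = (L, R)`: the bounded operator with
`(ξ · b) · x = ξ · R(b)`. For an essential bimodule over an algebra with a bounded approximate
unit it exists (`multRight_apply`) and is unique (`eq_multRight`). -/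
def multRight (x : 𝓜(ℂ, A)) : E →L[ℂ] E :=
  if h : ∃ T : E →L[ℂ] E, ∀ (b : A) (ξ : E),
    T (M.right (MulOpposite.op b) ξ) = M.right (MulOpposite.op (x.snd b)) ξ
  then h.choose else 0

/-- A net `ξ` is strictly almost central: `sup_{x ∈ S} ‖x · ξᵢ - ξᵢ · x‖ → 0` for each strictly
compact set `S` of multipliers. -/
def IsStrictlyAlmostCentral {I : Type w} [Preorder I] (ξ : I → E) : Prop :=
  ∀ S : Set 𝓜(ℂ, A), @IsCompact _ (strictTopology A) S → ∀ ε : ℝ, 0 < ε →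
    ∃ i₀, ∀ i, i₀ ≤ i → ∀ x ∈ S, ‖M.multLeft x (ξ i) - M.multRight x (ξ i)‖ < ε

/-- A pointwise limit of uniformly bounded operators which is known on a set with dense span. -/
theorem exists_limit_operator {l : Filter A} [l.NeBot] (T : A → E →L[ℂ] E) {C : ℝ}
    (hC : ∀ᶠ e in l, ‖T e‖ ≤ C) (D : Set E) (hD : Dense (Submodule.span ℂ D : Set E))
    (hT : ∀ ξ ∈ D, ∃ y, Tendsto (fun e => T e ξ) l (𝓝 y)) :
    ∃ S : E →L[ℂ] E, ∀ ξ, Tendsto (fun e => T e ξ) l (𝓝 (S ξ)) := by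
  have hspan : ∀ ξ ∈ Submodule.span ℂ D, ∃ y, Tendsto (fun e => T e ξ) l (𝓝 y) := by
    intro ξ hξ
    induction hξ using Submodule.span_induction with
    | mem ξ h => exact hT ξ h
    | zero => exact ⟨0, by simp⟩
    | add ξ η _ _ h₁ h₂ =>
      obtain ⟨y, hy⟩ := h₁
      obtain ⟨z, hz⟩ := h₂
      exact ⟨y + z, by simpa using hy.add hz⟩
    | smul c ξ _ h =>
      obtain ⟨y, hy⟩ := h
      exact ⟨c • y, by simpa using hy.const_smul c⟩
  have hC0 : 0 ≤ C := by
    obtain ⟨e, he⟩ := hC.exists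
    exact (norm_nonneg _).trans he
  have hall : ∀ ξ, ∃ y, Tendsto (fun e => T e ξ) l (𝓝 y) := by
    intro ξ
    refine CompleteSpace.complete (f := map (fun e => T e ξ) l) ?_
    rw [Metric.cauchy_iff]
    refine ⟨inferInstance, fun ε hε => ?_⟩
    have hδ : 0 < ε / (4 * (C + 1)) := by positivity
    obtain ⟨η, hη, hd⟩ := Metric.dense_iff.1 hD ξ _ hδ
    obtain ⟨y, hy⟩ := hspan η hd
    refine ⟨Metric.ball y (ε / 2), ?_, ?_⟩
    · change ∀ᶠ e in l, T e ξ ∈ Metric.ball y (ε / 2)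
      filter_upwards [hC, Metric.tendsto_nhds.1 hy (ε / 4) (by positivity)] with e he h2
      rw [Metric.mem_ball] at hη ⊢
      have h1 : dist (T e ξ) (T e η) ≤ ε / 4 := by
        rw [dist_eq_norm, ← map_sub]
        refine ((T e).le_opNorm _).trans ?_
        rw [dist_comm, dist_eq_norm] at hη
        calc ‖T e‖ * ‖ξ - η‖ ≤ (C + 1) * (ε / (4 * (C + 1))) := by
              gcongr
              linarith
          _ = ε / 4 := by field_simp
      linarith [dist_triangle (T e ξ) (T e η) y]
    · intro p hp q hq
      rw [Metric.mem_ball] at hp hq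
      linarith [dist_triangle_right p q y]
  choose F hF using hall
  refine ⟨LinearMap.mkContinuous
    { toFun := F
      map_add' := fun ξ η => tendsto_nhds_unique (hF (ξ + η))
        (by simpa using (hF ξ).add (hF η))
      map_smul' := fun c ξ => tendsto_nhds_unique (hF (c • ξ))
        (by simpa using (hF ξ).const_smul c) } C fun ξ => ?_, hF⟩
  refine le_of_tendsto (hF ξ).norm ?_
  filter_upwards [hC] with e he
  exact ((T e).le_opNorm ξ).trans (by gcongr)

variable {M}

theorem IsEssential.dense_left (h : M.IsEssential) :
    Dense (Submodule.span ℂ {ζ : E | ∃ (a : A) (ξ : E), ζ = M.left a ξ} : Set E) := by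
  refine h.mono (Submodule.span_mono ?_)
  rintro _ ⟨a, b, ξ, rfl⟩
  exact ⟨a, M.right (MulOpposite.op b) ξ,
    (DFunLike.congr_fun (M.commute a (MulOpposite.op b)) ξ).symm⟩

theorem IsEssential.dense_right (h : M.IsEssential) :
    Dense (Submodule.span ℂ
      {ζ : E | ∃ (b : A) (ξ : E), ζ = M.right (MulOpposite.op b) ξ} : Set E) := by
  refine h.mono (Submodule.span_mono ?_)
  rintro _ ⟨a, b, ξ, rfl⟩
  exact ⟨b, M.left a ξ, rfl⟩

/-- `L(ab) = L(a)b` for a multiplier `(L, R)`. -/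
theorem fst_mul {l : Filter A} (hl : l.IsApproximateUnit) (x : 𝓜(ℂ, A)) (a b : A) :
    x.fst (a * b) = x.fst a * b := by
  have := hl.neBot
  refine tendsto_nhds_unique (hl.tendsto_mul_right (x.fst (a * b))) ?_
  refine (hl.tendsto_mul_right (x.fst a * b)).congr fun c => ?_
  rw [← x.central, ← mul_assoc, ← x.central, mul_assoc]

/-- `R(ab) = aR(b)` for a multiplier `(L, R)`. -/
theorem snd_mul {l : Filter A} (hl : l.IsApproximateUnit) (x : 𝓜(ℂ, A)) (a b : A) :
    x.snd (a * b) = a * x.snd b := by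
  have := hl.neBot
  refine tendsto_nhds_unique (hl.tendsto_mul_left (x.snd (a * b))) ?_
  refine (hl.tendsto_mul_left (a * x.snd b)).congr fun c => ?_
  rw [x.central, mul_assoc, x.central, mul_assoc]

theorem multLeft_apply (hA : HasBoundedApproximateUnit A) (h : M.IsEssential) (x : 𝓜(ℂ, A))
    (a : A) (ξ : E) : M.multLeft x (M.left a ξ) = M.left (x.fst a) ξ := by
  obtain ⟨l, hl, C, hC⟩ := hA
  have := hl.neBot
  have hlim : ∀ (a : A) (ξ : E),
      Tendsto (fun e => M.left (x.fst e) (M.left a ξ)) l (𝓝 (M.left (x.fst a) ξ)) := by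
    intro a ξ
    have h1 : ∀ e, M.left (x.fst e) (M.left a ξ) = M.left (x.fst (e * a)) ξ := fun e => by
      rw [fst_mul hl, map_mul]
      rfl
    simp only [h1]
    have hc : Continuous M.left := AddMonoidHomClass.continuous_of_bound M.left 1
      fun a => by simpa using M.norm_left_le a
    exact ((ContinuousLinearMap.apply ℂ E ξ).continuous.comp
      (hc.comp x.fst.continuous)).continuousAt.tendsto.comp (hl.tendsto_mul_right a)
  have hex : ∃ T : E →L[ℂ] E, ∀ (a : A) (ξ : E), T (M.left a ξ) = M.left (x.fst a) ξ := by
    obtain ⟨S, hS⟩ := exists_limit_operator (l := l) (fun e => M.left (x.fst e))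
      (C := ‖x.fst‖ * C) (by
        filter_upwards [hC] with e he
        exact (M.norm_left_le _).trans ((x.fst.le_opNorm e).trans (by gcongr)))
      _ h.dense_left (by
        rintro _ ⟨a, ξ, rfl⟩
        exact ⟨_, hlim a ξ⟩)
    exact ⟨S, fun a ξ => tendsto_nhds_unique (hS _) (hlim a ξ)⟩
  rw [multLeft, dif_pos hex]
  exact hex.choose_spec a ξ

theorem multRight_apply (hA : HasBoundedApproximateUnit A) (h : M.IsEssential) (x : 𝓜(ℂ, A))
    (b : A) (ξ : E) : M.multRight x (M.right (MulOpposite.op b) ξ)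
      = M.right (MulOpposite.op (x.snd b)) ξ := by
  obtain ⟨l, hl, C, hC⟩ := hA
  have := hl.neBot
  have hlim : ∀ (b : A) (ξ : E),
      Tendsto (fun e => M.right (MulOpposite.op (x.snd e)) (M.right (MulOpposite.op b) ξ)) l
        (𝓝 (M.right (MulOpposite.op (x.snd b)) ξ)) := by
    intro b ξ
    have h1 : ∀ e, M.right (MulOpposite.op (x.snd e)) (M.right (MulOpposite.op b) ξ)
        = M.right (MulOpposite.op (x.snd (b * e))) ξ := fun e => by
      rw [snd_mul hl, MulOpposite.op_mul, map_mul]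
      rfl
    simp only [h1]
    have hc : Continuous M.right := AddMonoidHomClass.continuous_of_bound M.right 1
      fun a => by simpa using M.norm_right_le a
    exact ((ContinuousLinearMap.apply ℂ E ξ).continuous.comp
      (hc.comp (MulOpposite.continuous_op.comp x.snd.continuous))).continuousAt.tendsto.comp
        (hl.tendsto_mul_left b)
  have hex : ∃ T : E →L[ℂ] E, ∀ (b : A) (ξ : E),
      T (M.right (MulOpposite.op b) ξ) = M.right (MulOpposite.op (x.snd b)) ξ := by
    obtain ⟨S, hS⟩ := exists_limit_operator (l := l)
      (fun e => M.right (MulOpposite.op (x.snd e))) (C := ‖x.snd‖ * C) (by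
        filter_upwards [hC] with e he
        exact (M.norm_right_le _).trans ((x.snd.le_opNorm e).trans (by gcongr)))
      _ h.dense_right (by
        rintro _ ⟨b, ξ, rfl⟩
        exact ⟨_, hlim b ξ⟩)
    exact ⟨S, fun b ξ => tendsto_nhds_unique (hS _) (hlim b ξ)⟩
  rw [multRight, dif_pos hex]
  exact hex.choose_spec b ξ

theorem eq_multLeft (hA : HasBoundedApproximateUnit A) (h : M.IsEssential) (x : 𝓜(ℂ, A))
    (T : E →L[ℂ] E) (hT : ∀ (a : A) (ξ : E), T (M.left a ξ) = M.left (x.fst a) ξ) :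
    T = M.multLeft x := by
  refine ContinuousLinearMap.ext_on h.dense_left ?_
  rintro _ ⟨a, ξ, rfl⟩
  rw [hT, multLeft_apply hA h]

theorem eq_multRight (hA : HasBoundedApproximateUnit A) (h : M.IsEssential) (x : 𝓜(ℂ, A))
    (T : E →L[ℂ] E) (hT : ∀ (b : A) (ξ : E),
      T (M.right (MulOpposite.op b) ξ) = M.right (MulOpposite.op (x.snd b)) ξ) :
    T = M.multRight x := by
  refine ContinuousLinearMap.ext_on h.dense_right ?_
  rintro _ ⟨b, ξ, rfl⟩
  rw [hT, multRight_apply hA h]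

end Bimodule

/-- Weak property `(T_𝓔)` for the Banach algebra `A` (which is required to have a bounded
approximate unit). -/
def WeakPropertyT (𝓔 : Set BanachSp.{u}) : Prop :=
  HasBoundedApproximateUnit A ∧
  ∀ E ∈ 𝓔, ∀ M : Bimodule A E, M.IsEssential →
    (∃ (I : Type w) (_ : Preorder I) (_ : IsDirectedOrder I) (_ : Nonempty I) (ξ : I → E),
      (∀ i, ‖ξ i‖ = 1) ∧ M.IsStrictlyAlmostCentral ξ) →
    ∃ ξ : E, ξ ≠ 0 ∧ M.IsCentral ξ

end Algebra

end BanachT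

end

/-!
Write `A = F*_𝓔(G)`. Point masses act on `A` as multipliers: `δₛ = (π(s))_π` acts on the family
`(π(f))_π` by left and right translation of `f`, contractively and norm continuously in `s`
(`SymPF.continuous_delta`), and `g * a = ∫ g(s) δₛ a ds`, `a * g = ∫ g(s) a δₛ ds` for `g`
continuous with compact support. Hence probability densities concentrating at the identity form an
approximate unit of `A` of norm at most one (`SymPF.isApproximateUnit_bumpFilter`).

From the group to the algebra: on an essential `A`-bimodule, `ξ ↦ δₛ · ξ · δₛ⁻¹` is a continuous
isometric representation (`Bimodule.conjRep`). Since `s ↦ δₛ` is strictly continuous, it maps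
compact sets to strictly compact ones, so strictly almost central vectors are almost invariant;
and since `g · ξ` and `ξ · g` are the integrals of `g(s) δₛ · ξ` and `g(s) ξ · δₛ`, invariant
vectors are central (`Bimodule.isCentral_of_isInvariant`).

From the algebra to the group: if `π` has almost invariant unit vectors `ξᵢ`, then `π(g) ξᵢ` is
asymptotically `(∫ g) ξᵢ`, so `|∫ g| ≤ ‖π(g)‖` and the integral extends to a contractive character
`1` of `A` (`SymPF.trivChar`), with `π(a) ξᵢ - 1(a) ξᵢ → 0` uniformly on compact sets of `a`. The
space of `π` becomes an essential `A`-bimodule with left action `π` and right action `1`. Fixing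
`e` with `1(e) = 1`, a multiplier `x` satisfies `x · ξᵢ - ξᵢ · x ≈ π(xe) ξᵢ - 1(xe) ξᵢ`; on a
strictly compact set of `x` the elements `xe` form a compact set and the norms are bounded, so the
net is strictly almost central (`SymPF.strictlyAlmostCentral_trivBimodule`). A central vector
satisfies `π(a) ξ = 1(a) ξ`, and comparing `a = e` with `a = δₛ e` shows that it is invariant.
-/

noncomputable section

set_option linter.unusedSectionVars false

open MeasureTheory Filter Topology
open scoped ENNReal MultiplierAlgebra Pointwise

namespace BanachT

/-! ### Generalities on families of contractions -/

/-- Strong continuity of a bounded family of operators may be checked on a set with dense span. -/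
theorem continuous_apply_of_dense_span {X F : Type*} [TopologicalSpace X] [NormedAddCommGroup F]
    [NormedSpace ℂ F] {T : X → F →L[ℂ] F} (hT : ∀ s, ‖T s‖ ≤ 1) {D : Set F}
    (hD : Dense (Submodule.span ℂ D : Set F)) (hc : ∀ ξ ∈ D, Continuous fun s => T s ξ) (ξ : F) :
    Continuous fun s => T s ξ := by
  have hspan : ∀ ξ ∈ Submodule.span ℂ D, Continuous fun s => T s ξ := by
    intro ξ hξ
    induction hξ using Submodule.span_induction with
    | mem ξ h => exact hc ξ h
    | zero => simpa using continuous_const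
    | add ξ η _ _ h₁ h₂ => simpa only [map_add] using h₁.fun_add h₂
    | smul c ξ _ h => simpa only [map_smul] using h.fun_const_smul c
  refine continuous_of_uniform_approx_of_continuous fun u hu => ?_
  obtain ⟨ε, hε, hu⟩ := Metric.mem_uniformity_dist.1 hu
  obtain ⟨η, hη, hd⟩ := Metric.dense_iff.1 hD ξ ε hε
  refine ⟨_, hspan η hd, fun s => hu ?_⟩
  rw [dist_eq_norm, ← map_sub]
  rw [Metric.mem_ball, dist_comm, dist_eq_norm] at hη
  exact ((T s).le_of_opNorm_le (hT s) _).trans_lt (by simpa using hη)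

/-- A strongly continuous family of contractions acts continuously on a moving vector. -/
theorem continuous_apply_apply {X F : Type*} [TopologicalSpace X] [NormedAddCommGroup F]
    [NormedSpace ℂ F] {T : X → F →L[ℂ] F} (hT : ∀ s, ‖T s‖ ≤ 1)
    (hc : ∀ ξ, Continuous fun s => T s ξ) {c : X → F} (hcc : Continuous c) :
    Continuous fun s => T s (c s) := by
  rw [continuous_iff_continuousAt]
  intro s₀
  rw [ContinuousAt, tendsto_iff_norm_sub_tendsto_zero]
  have h1 := tendsto_iff_norm_sub_tendsto_zero.1 (hcc.tendsto s₀)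
  have h2 := tendsto_iff_norm_sub_tendsto_zero.1 ((hc (c s₀)).tendsto s₀)
  refine squeeze_zero (fun _ => norm_nonneg _) (fun s => ?_) (by simpa using h1.add h2)
  have : T s (c s) - T s₀ (c s₀) = T s (c s - c s₀) + (T s (c s₀) - T s₀ (c s₀)) := by
    rw [map_sub]
    abel
  rw [this]
  refine (norm_add_le _ _).trans (add_le_add_left ?_ _)
  simpa using (T s).le_of_opNorm_le (hT s) (c s - c s₀)

/-- A strongly continuous homomorphism from a group to the contractions of a Banach space is an
isometric representation. -/
def IsomRep.ofContractive {G : Type v} [Group G] [TopologicalSpace G] {E : BanachSp.{u}}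
    (T : G → E →L[ℂ] E) (h1 : T 1 = 1) (hmul : ∀ s t, T (s * t) = T s * T t)
    (hnorm : ∀ s, ‖T s‖ ≤ 1) (hc : ∀ ξ, Continuous fun s => T s ξ) : IsomRep G E where
  toHom :=
    { toFun := fun s =>
        { toFun := T s
          invFun := T s⁻¹
          map_add' := map_add _
          map_smul' := map_smul _
          left_inv := fun ξ => by
            change (T s⁻¹ * T s) ξ = ξ
            rw [← hmul, inv_mul_cancel, h1]
            rfl
          right_inv := fun ξ => by
            change (T s * T s⁻¹) ξ = ξ
            rw [← hmul, mul_inv_cancel, h1]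
            rfl
          norm_map' := fun ξ => by
            refine le_antisymm (by simpa using (T s).le_of_opNorm_le (hnorm s) ξ) ?_
            have h : T s⁻¹ (T s ξ) = ξ := by
              change (T s⁻¹ * T s) ξ = ξ
              rw [← hmul, inv_mul_cancel, h1]
              rfl
            have := (T s⁻¹).le_of_opNorm_le (hnorm s⁻¹) (T s ξ)
            rwa [h, one_mul] at this }
      map_one' := LinearIsometryEquiv.ext fun ξ => by
        change T 1 ξ = ξ
        rw [h1]
        rfl
      map_mul' := fun s t => LinearIsometryEquiv.ext fun ξ => by
        change T (s * t) ξ = T s (T t ξ)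
        rw [hmul]
        rfl }
  continuous_orbit := hc

/-- Weak property `(T_𝓔)` without nets: it suffices to have, for every compact set and every
tolerance, a single unit vector that is almost invariant. -/
theorem GroupWeakPropertyT.exists_invariant {G : Type v} [Group G] [TopologicalSpace G]
    {𝓔 : Set BanachSp.{u}} (hG : GroupWeakPropertyT G 𝓔) {E : BanachSp.{u}} (hE : E ∈ 𝓔)
    (π : IsomRep G E) (h : ∀ K : Set G, IsCompact K → ∀ ε : ℝ, 0 < ε →
      ∃ ξ : E, ‖ξ‖ = 1 ∧ ∀ s ∈ K, ‖π.toHom s ξ - ξ‖ < ε) :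
    ∃ ξ : E, ξ ≠ 0 ∧ π.IsInvariant ξ := by
  choose ξ hξ1 hξ using fun p : TopologicalSpace.Compacts G × ℕ =>
    h p.1 p.1.isCompact (1 / ((p.2 : ℝ) + 1)) (by positivity)
  refine hG E hE π ⟨TopologicalSpace.Compacts G × ℕ, inferInstance, inferInstance, inferInstance,
    ξ, hξ1, fun K hK ε hε => ?_⟩
  obtain ⟨n, hn⟩ := exists_nat_one_div_lt hε
  refine ⟨(⟨K, hK⟩, n), fun p hp s hs => (hξ p s (hp.1 hs)).trans ?_⟩
  refine lt_of_le_of_lt ?_ hn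
  have : (n : ℝ) ≤ p.2 := by exact_mod_cast hp.2
  gcongr

/-! ### Integrals against compactly supported functions on the group -/

section Integrals

variable {G : Type v} [Group G] [TopologicalSpace G] [IsTopologicalGroup G]
  [LocallyCompactSpace G] [T2Space G] [MeasurableSpace G] [BorelSpace G]

/-- A parametric integral is continuous if the integrand is continuous and, locally in the
parameter, supported in a fixed compact set. -/
theorem continuous_integral_of_locally_compact_support {F : Type*} [NormedAddCommGroup F]
    [NormedSpace ℝ F] {Φ : G → G → F} (hΦ : Continuous fun p : G × G => Φ p.1 p.2)
    (hloc : ∀ K : Set G, IsCompact K → ∃ L : Set G, IsCompact L ∧ ∀ s ∈ K, ∀ x ∉ L, Φ s x = 0) :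
    Continuous fun s => ∫ x, Φ s x ∂(Measure.haar : Measure G) := by
  rw [continuous_iff_continuousAt]
  intro s₀
  obtain ⟨K, hK, hs₀⟩ := exists_compact_mem_nhds s₀
  obtain ⟨L, hL, h⟩ := hloc K hK
  exact (continuousOn_integral_of_compact_support hL hΦ.continuousOn
    (fun s x hs hx => h s hs x hx)).continuousAt hs₀

theorem continuous_of_ae_eq_family {Φ : G → G → ℂ} (hΦ : Continuous fun p : G × G => Φ p.1 p.2)
    (hloc : ∀ K : Set G, IsCompact K → ∃ L : Set G, IsCompact L ∧ ∀ s ∈ K, ∀ x ∉ L, Φ s x = 0)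
    {f : G → L1 G} (hf : ∀ s, f s =ᵐ[Measure.haar] Φ s) : Continuous f := by
  rw [continuous_iff_continuousAt]
  intro s₀
  have hnorm : ∀ s, ‖f s - f s₀‖ = ∫ x, ‖Φ s x - Φ s₀ x‖ ∂Measure.haar := by
    intro s
    rw [L1.norm_eq_integral_norm]
    refine integral_congr_ae ?_
    filter_upwards [Lp.coeFn_sub (f s) (f s₀), hf s, hf s₀] with x h1 h2 h3
    rw [h1, Pi.sub_apply, h2, h3]
  have hcont : Continuous fun s => ∫ x, ‖Φ s x - Φ s₀ x‖ ∂(Measure.haar : Measure G) := by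
    refine continuous_integral_of_locally_compact_support ?_ ?_
    · exact (hΦ.sub (hΦ.comp (continuous_const.prodMk continuous_snd))).norm
    · intro K hK
      obtain ⟨L, hL, h⟩ := hloc (insert s₀ K) (hK.insert s₀)
      exact ⟨L, hL, fun s hs x hx => by
        simp [h s (Set.mem_insert_of_mem _ hs) x hx, h s₀ (Set.mem_insert _ _) x hx]⟩
  rw [ContinuousAt, tendsto_iff_norm_sub_tendsto_zero]
  simp only [hnorm]
  simpa using hcont.tendsto s₀

theorem map_mul_right_haar (s : G) :
    Measure.map (· * s) (Measure.haar : Measure G)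
      = Measure.modularCharacterFun s • (Measure.haar : Measure G) := by
  have : (Measure.map (· * s) (Measure.haar : Measure G)).Regular :=
    Measure.Regular.map (Homeomorph.mulRight s)
  rw [Measure.modularCharacterFun_eq_haarScalarFactor (Measure.haar : Measure G) s]
  exact Measure.isMulLeftInvariant_eq_smul_of_regular _ _

theorem integral_mul_right_haar {F : Type*} [NormedAddCommGroup F] [NormedSpace ℝ F]
    (φ : G → F) (s : G) : ∫ x, φ (x * s) ∂(Measure.haar : Measure G)
      = (Measure.modularCharacterFun s : ℝ) • ∫ x, φ x ∂(Measure.haar : Measure G) := by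
  have h := integral_smul_nnreal_measure φ (Measure.modularCharacterFun s)
    (μ := (Measure.haar : Measure G))
  rw [← map_mul_right_haar s, NNReal.smul_def] at h
  rw [← h]
  exact ((Homeomorph.mulRight s).measurableEmbedding.integral_map φ).symm

theorem continuous_modularCharacterFun :
    Continuous fun s : G => (Measure.modularCharacterFun s : ℝ) := by
  obtain ⟨⟨f, f_cont⟩, f_comp, f_nonneg, f_one⟩ :
    ∃ f : C(G, ℝ), HasCompactSupport f ∧ 0 ≤ f ∧ f 1 ≠ 0 := exists_continuous_nonneg_pos 1
  have hne : ∫ x, f x ∂(Measure.haar : Measure G) ≠ 0 :=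
    ne_of_gt (f_cont.integral_pos_of_hasCompactSupport_nonneg_nonzero f_comp f_nonneg f_one)
  have h : (fun s : G => (Measure.modularCharacterFun s : ℝ))
      = fun s => (∫ x, f (x * s) ∂(Measure.haar : Measure G)) /
          ∫ x, f x ∂(Measure.haar : Measure G) := by
    funext s
    rw [integral_mul_right_haar f s, smul_eq_mul, mul_div_cancel_right₀ _ hne]
  rw [h]
  refine (continuous_integral_of_locally_compact_support
    (Φ := fun s x => f (x * s)) (f_cont.comp (continuous_snd.mul continuous_fst)) ?_).div_const _
  intro K hK
  refine ⟨tsupport f * K⁻¹, IsCompact.mul f_comp hK.inv, fun s hs x hx => ?_⟩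
  by_contra h
  exact hx ⟨x * s, subset_tsupport f h, s⁻¹, Set.inv_mem_inv.2 hs, by simp⟩

/-- The element of `L¹(G)` given by a continuous function with compact support. -/
def ccL1 (g : G → ℂ) (hg : Continuous g) (hgs : HasCompactSupport g) : L1 G :=
  MemLp.toLp g (memLp_one_iff_integrable.2 (hg.integrable_of_hasCompactSupport hgs))

theorem coeFn_ccL1 {g : G → ℂ} (hg : Continuous g) (hgs : HasCompactSupport g) :
    ccL1 g hg hgs =ᵐ[Measure.haar] g := MemLp.coeFn_toLp _

theorem IsCc.exists_eq_ccL1 {f : L1 G} (hf : IsCc f) :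
    ∃ (g : G → ℂ) (hg : Continuous g) (hgs : HasCompactSupport g), f = ccL1 g hg hgs := by
  obtain ⟨g, hg, hgs, h⟩ := hf
  exact ⟨g, hg, hgs, Lp.ext (h.trans (coeFn_ccL1 hg hgs).symm)⟩

theorem integrated_ccL1 {E : BanachSp.{u}} (π : IsomRep G E) {g : G → ℂ} (hg : Continuous g)
    (hgs : HasCompactSupport g) (ξ : E) :
    integrated π (ccL1 g hg hgs) ξ = ∫ s, g s • π.toHom s ξ ∂Measure.haar :=
  integrated_of_ae π (coeFn_ccL1 hg hgs) ξ

/-- The function `x ↦ g(s⁻¹x)`. -/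
def leftTrans (s : G) (g : G → ℂ) (x : G) : ℂ := g (s⁻¹ * x)

/-- The function `x ↦ Δ(s) g(xs⁻¹)`, where `∫ φ(xs) dx = Δ(s) ∫ φ(x) dx`. -/
def rightTrans (s : G) (g : G → ℂ) (x : G) : ℂ :=
  ((Measure.modularCharacterFun s : ℝ) : ℂ) * g (x * s⁻¹)

variable {g : G → ℂ}

theorem continuous_leftTrans_uncurry (hg : Continuous g) :
    Continuous fun p : G × G => leftTrans p.1 g p.2 :=
  hg.comp (continuous_fst.inv.mul continuous_snd)

theorem continuous_rightTrans_uncurry (hg : Continuous g) :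
    Continuous fun p : G × G => rightTrans p.1 g p.2 :=
  (Complex.continuous_ofReal.comp (continuous_modularCharacterFun.comp continuous_fst)).mul
    (hg.comp (continuous_snd.mul continuous_fst.inv))

theorem exists_compact_leftTrans (hgs : HasCompactSupport g) (K : Set G) (hK : IsCompact K) :
    ∃ L : Set G, IsCompact L ∧ ∀ s ∈ K, ∀ x ∉ L, leftTrans s g x = 0 := by
  refine ⟨K * tsupport g, hK.mul hgs, fun s hs x hx => ?_⟩
  by_contra h
  exact hx ⟨s, hs, s⁻¹ * x, subset_tsupport g h, by simp⟩

theorem exists_compact_rightTrans (hgs : HasCompactSupport g) (K : Set G) (hK : IsCompact K) :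
    ∃ L : Set G, IsCompact L ∧ ∀ s ∈ K, ∀ x ∉ L, rightTrans s g x = 0 := by
  refine ⟨tsupport g * K, IsCompact.mul hgs hK, fun s hs x hx => ?_⟩
  by_contra h
  exact hx ⟨x * s⁻¹, subset_tsupport g (right_ne_zero_of_mul h), s, hs, by simp⟩

theorem continuous_leftTrans (hg : Continuous g) (s : G) : Continuous (leftTrans s g) :=
  (continuous_leftTrans_uncurry hg).comp (continuous_const.prodMk continuous_id)

theorem continuous_rightTrans (hg : Continuous g) (s : G) : Continuous (rightTrans s g) :=
  (continuous_rightTrans_uncurry hg).comp (continuous_const.prodMk continuous_id)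

theorem hasCompactSupport_leftTrans (hgs : HasCompactSupport g) (s : G) :
    HasCompactSupport (leftTrans s g) := by
  obtain ⟨L, hL, h⟩ := exists_compact_leftTrans hgs {s} isCompact_singleton
  exact HasCompactSupport.intro hL fun x hx => h s rfl x hx

theorem hasCompactSupport_rightTrans (hgs : HasCompactSupport g) (s : G) :
    HasCompactSupport (rightTrans s g) := by
  obtain ⟨L, hL, h⟩ := exists_compact_rightTrans hgs {s} isCompact_singleton
  exact HasCompactSupport.intro hL fun x hx => h s rfl x hx

/-- `π(s) π(g) = π(δₛ * g)`. -/
theorem integrated_leftTrans {E : BanachSp.{u}} (π : IsomRep G E) (hg : Continuous g)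
    (hgs : HasCompactSupport g) (s : G) (ξ : E) :
    π.toHom s (integrated π (ccL1 g hg hgs) ξ) = integrated π (ccL1 (leftTrans s g)
      (continuous_leftTrans hg s) (hasCompactSupport_leftTrans hgs s)) ξ := by
  rw [integrated_ccL1, integrated_ccL1]
  have h := ((π.toHom s).toContinuousLinearEquiv : E →L[ℂ] E).integral_comp_comm
    ((continuous_smul_orbit π hg ξ).integrable_of_hasCompactSupport
      (μ := Measure.haar) hgs.smul_right)
  refine h.symm.trans ?_
  rw [← integral_mul_left_eq_self (fun x => leftTrans s g x • π.toHom x ξ) s]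
  refine integral_congr_ae (Eventually.of_forall fun t => ?_)
  simp [leftTrans, map_mul]

/-- `π(g) π(s) = π(g * δₛ)`. -/
theorem integrated_rightTrans {E : BanachSp.{u}} (π : IsomRep G E) (hg : Continuous g)
    (hgs : HasCompactSupport g) (s : G) (ξ : E) :
    integrated π (ccL1 g hg hgs) (π.toHom s ξ) = integrated π (ccL1 (rightTrans s g)
      (continuous_rightTrans hg s) (hasCompactSupport_rightTrans hgs s)) ξ := by
  rw [integrated_ccL1, integrated_ccL1]
  have h := integral_mul_right_haar (fun x => g (x * s⁻¹) • π.toHom x ξ) s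
  simp only [mul_inv_cancel_right, map_mul] at h
  refine h.trans ?_
  rw [← integral_smul]
  refine integral_congr_ae (Eventually.of_forall fun t => ?_)
  simp only [rightTrans, mul_smul, Complex.coe_smul]

/-- A probability density supported in a given neighbourhood of the identity. -/
structure IsBump (U : Set G) (g : G → ℂ) : Prop where
  continuous : Continuous g
  hasCompactSupport : HasCompactSupport g
  eq_zero : ∀ s ∉ U, g s = 0
  integral_eq_one : ∫ s, g s ∂(Measure.haar : Measure G) = 1
  integral_norm : ∫ s, ‖g s‖ ∂(Measure.haar : Measure G) = 1

theorem IsBump.mono {U V : Set G} (h : IsBump U g) (hUV : U ⊆ V) : IsBump V g :=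
  { h with eq_zero := fun s hs => h.eq_zero s fun hU => hs (hUV hU) }

theorem exists_isBump {U : Set G} (hU : U ∈ 𝓝 (1 : G)) : ∃ g : G → ℂ, IsBump U g := by
  obtain ⟨V, hVU, hV, h1⟩ := mem_nhds_iff.1 hU
  obtain ⟨f, hf1, hfV, hfc, hf01⟩ := exists_continuous_one_zero_of_isCompact
    (isCompact_singleton (x := (1 : G))) hV.isClosed_compl
    (Set.disjoint_compl_right_iff_subset.2 (Set.singleton_subset_iff.2 h1))
  have hpos : 0 < ∫ x, f x ∂(Measure.haar : Measure G) :=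
    f.continuous.integral_pos_of_hasCompactSupport_nonneg_nonzero hfc (fun x => (hf01 x).1)
      (x := 1) (by rw [hf1 rfl]; simp)
  set c := ∫ x, f x ∂(Measure.haar : Measure G) with hc
  refine ⟨fun x => ((f x / c : ℝ) : ℂ), ?_, ?_, ?_, ?_, ?_⟩
  · exact Complex.continuous_ofReal.comp (f.continuous.div_const c)
  · refine hfc.mono fun x hx => ?_
    contrapose! hx
    simp only [Function.mem_support, ne_eq, not_not] at hx ⊢
    simp [hx]
  · intro s hs
    have : f s = 0 := hfV fun h => hs (hVU h)
    simp [this]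
  · rw [integral_complex_ofReal, integral_div, ← hc, div_self hpos.ne']
    simp
  · have : ∀ x, ‖((f x / c : ℝ) : ℂ)‖ = f x / c := fun x => by
      rw [Complex.norm_real, Real.norm_of_nonneg (div_nonneg (hf01 x).1 hpos.le)]
    simp only [this]
    rw [integral_div, ← hc, div_self hpos.ne']

theorem norm_integral_smul_le_of_forall {F : Type*} [NormedAddCommGroup F] [NormedSpace ℂ F]
    (hg : Continuous g) (hgs : HasCompactSupport g) {c : G → F}
    {ε : ℝ} (h : ∀ s, g s ≠ 0 → ‖c s‖ ≤ ε) :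
    ‖∫ s, g s • c s ∂(Measure.haar : Measure G)‖
      ≤ (∫ s, ‖g s‖ ∂(Measure.haar : Measure G)) * ε := by
  rw [← integral_mul_const]
  refine norm_integral_le_of_norm_le
    ((hg.norm.integrable_of_hasCompactSupport hgs.norm).mul_const ε)
    (Eventually.of_forall fun s => ?_)
  rw [norm_smul]
  by_cases hs : g s = 0
  · simp [hs]
  · exact mul_le_mul_of_nonneg_left (h s hs) (norm_nonneg _)

theorem integrable_smul_of_cc {F : Type*} [NormedAddCommGroup F] [NormedSpace ℂ F]
    (hg : Continuous g) (hgs : HasCompactSupport g) {c : G → F} (hc : Continuous c) :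
    Integrable (fun s => g s • c s) (Measure.haar : Measure G) :=
  (hg.smul hc).integrable_of_hasCompactSupport hgs.smul_right

/-- `∫ g(s) c(s) ds - (∫ g) y` is small if `c` is close to `y` on the support of `g`. -/
theorem norm_integral_smul_sub_le {F : Type*} [NormedAddCommGroup F] [NormedSpace ℂ F]
    [CompleteSpace F] (hg : Continuous g) (hgs : HasCompactSupport g) {c : G → F}
    (hc : Continuous c) {y : F} {ε : ℝ} (h : ∀ s, g s ≠ 0 → ‖c s - y‖ ≤ ε) :
    ‖(∫ s, g s • c s ∂(Measure.haar : Measure G)) - (∫ s, g s ∂(Measure.haar : Measure G)) • y‖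
      ≤ (∫ s, ‖g s‖ ∂(Measure.haar : Measure G)) * ε := by
  rw [← integral_smul_const, ← integral_sub (integrable_smul_of_cc hg hgs hc)
    (integrable_smul_of_cc hg hgs continuous_const)]
  simp only [← smul_sub]
  exact norm_integral_smul_le_of_forall hg hgs h

theorem IsBump.norm_integral_smul_sub_le {F : Type*} [NormedAddCommGroup F] [NormedSpace ℂ F]
    [CompleteSpace F] {U : Set G} (hg : IsBump U g) {c : G → F} (hc : Continuous c) {y : F}
    {ε : ℝ} (h : ∀ s ∈ U, ‖c s - y‖ ≤ ε) :
    ‖(∫ s, g s • c s ∂(Measure.haar : Measure G)) - y‖ ≤ ε := by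
  have := BanachT.norm_integral_smul_sub_le hg.continuous hg.hasCompactSupport hc (y := y)
    (ε := ε) fun s hs => h s (by_contra fun hU => hs (hg.eq_zero s hU))
  rwa [hg.integral_eq_one, hg.integral_norm, one_smul, one_mul] at this

end Integrals

/-! ### Translations of the symmetrized pseudofunction algebra -/

section Translations

variable {G : Type v} [Group G] [TopologicalSpace G] [IsTopologicalGroup G]
  [LocallyCompactSpace G] [T2Space G] [MeasurableSpace G] [BorelSpace G]
  {R : ∀ E : BanachSp.{u}, IsomRep G E → Prop}

variable (R) in
/-- The family `(π(s))_{π ∈ R*}`. -/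
def deltaOp (s : G) : Ops R :=
  (⟨fun p => ((p.1.2.toHom s).toContinuousLinearEquiv : p.1.1 →L[ℂ] p.1.1), memℓp_infty ⟨1, by
    rintro _ ⟨p, rfl⟩
    exact ContinuousLinearMap.opNorm_le_bound _ zero_le_one fun ξ => by simp⟩⟩ :
    lp (fun p : Idx R => (p.1.1 →L[ℂ] p.1.1)) ∞)

/-- The component at `p` of a family of operators. -/
def Ops.comp (x : Ops R) (p : Idx R) : p.1.1 →L[ℂ] p.1.1 :=
  (show lp (fun p : Idx R => (p.1.1 →L[ℂ] p.1.1)) ∞ from x).1 p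

theorem Ops.ext {x y : Ops R} (h : ∀ p ξ, x.comp p ξ = y.comp p ξ) : x = y :=
  lp.ext (funext fun p => ContinuousLinearMap.ext (h p))

theorem Ops.norm_comp_le (x : Ops R) (p : Idx R) : ‖x.comp p‖ ≤ ‖x‖ :=
  lp.norm_apply_le_norm (E := fun p : Idx R => (p.1.1 →L[ℂ] p.1.1)) ENNReal.top_ne_zero x p

theorem Ops.comp_mul (x y : Ops R) (p : Idx R) (ξ : p.1.1) :
    (x * y).comp p ξ = x.comp p (y.comp p ξ) := rfl

theorem comp_deltaOp (s : G) (p : Idx R) (ξ : p.1.1) :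
    (deltaOp R s).comp p ξ = p.1.2.toHom s ξ := rfl

theorem norm_deltaOp_le (s : G) : ‖deltaOp R s‖ ≤ 1 :=
  lp.norm_le_of_forall_le zero_le_one fun p : Idx R =>
    ContinuousLinearMap.opNorm_le_bound _ zero_le_one fun ξ => by
      rw [one_mul]
      exact ((p.1.2.toHom s).norm_map ξ).le

theorem deltaOp_mul (s t : G) : deltaOp R (s * t) = deltaOp R s * deltaOp R t :=
  Ops.ext fun p ξ => by simp [Ops.comp_mul, comp_deltaOp]

theorem deltaOp_one_mul (x : Ops R) : deltaOp R 1 * x = x :=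
  Ops.ext fun p ξ => by simp [Ops.comp_mul, comp_deltaOp]

theorem mul_deltaOp_one (x : Ops R) : x * deltaOp R 1 = x :=
  Ops.ext fun p ξ => by simp [Ops.comp_mul, comp_deltaOp]

theorem deltaOp_mul_toOps {g : G → ℂ} (hg : Continuous g) (hgs : HasCompactSupport g) (s : G) :
    deltaOp R s * toOps R (ccL1 g hg hgs) = toOps R (ccL1 (leftTrans s g)
      (continuous_leftTrans hg s) (hasCompactSupport_leftTrans hgs s)) :=
  Ops.ext fun p ξ => integrated_leftTrans p.1.2 hg hgs s ξ

theorem toOps_mul_deltaOp {g : G → ℂ} (hg : Continuous g) (hgs : HasCompactSupport g) (s : G) :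
    toOps R (ccL1 g hg hgs) * deltaOp R s = toOps R (ccL1 (rightTrans s g)
      (continuous_rightTrans hg s) (hasCompactSupport_rightTrans hgs s)) :=
  Ops.ext fun p ξ => integrated_rightTrans p.1.2 hg hgs s ξ

theorem closure_range_toOps_subset :
    closure (Set.range (toOps R)) ⊆ closure (toOps R '' {h : L1 G | IsCc h}) :=
  closure_minimal (by rintro _ ⟨f, rfl⟩; exact mem_closure_toOps_Cc R f) isClosed_closure

theorem deltaOp_mul_mem (s : G) {x : Ops R} (hx : x ∈ symPFSubalgebra R) :
    deltaOp R s * x ∈ symPFSubalgebra R := by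
  refine map_mem_closure (f := fun x => deltaOp R s * x) (continuous_const.mul continuous_id)
    (closure_range_toOps_subset hx) ?_
  rintro _ ⟨f, hf, rfl⟩
  obtain ⟨g, hg, hgs, rfl⟩ := IsCc.exists_eq_ccL1 hf
  exact ⟨_, (deltaOp_mul_toOps hg hgs s).symm⟩

theorem mul_deltaOp_mem (s : G) {x : Ops R} (hx : x ∈ symPFSubalgebra R) :
    x * deltaOp R s ∈ symPFSubalgebra R := by
  refine map_mem_closure (f := fun x => x * deltaOp R s) (continuous_id.mul continuous_const)
    (closure_range_toOps_subset hx) ?_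
  rintro _ ⟨f, hf, rfl⟩
  obtain ⟨g, hg, hgs, rfl⟩ := IsCc.exists_eq_ccL1 hf
  exact ⟨_, (toOps_mul_deltaOp hg hgs s).symm⟩

namespace SymPF

/-- The underlying family of operators of an element of `F*_R(G)`. -/
def ops (a : SymPF R) : Ops R := (show symPFSubalgebra R from a).1

theorem ops_injective : Function.Injective (ops : SymPF R → Ops R) := Subtype.val_injective

theorem ops_mul (a b : SymPF R) : (a * b).ops = a.ops * b.ops := rfl

/-- The representation of `F*_R(G)` on the space of the representation `p ∈ R*`. -/
def rep (p : Idx R) : SymPF R →ₙₐ[ℂ] (p.1.1 →L[ℂ] p.1.1) where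
  toFun a := a.ops.comp p
  map_smul' _ _ := rfl
  map_zero' := rfl
  map_add' _ _ := rfl
  map_mul' _ _ := rfl

theorem norm_rep_le (p : Idx R) (a : SymPF R) : ‖rep p a‖ ≤ ‖a‖ := a.ops.norm_comp_le p

theorem ext_rep {a b : SymPF R} (h : ∀ p ξ, rep p a ξ = rep p b ξ) : a = b :=
  ops_injective (Ops.ext h)

/-- The evaluation `a ↦ π(a) ξ` as a bounded operator. -/
def evalCLM (p : Idx R) (ξ : p.1.1) : SymPF R →L[ℂ] p.1.1 :=
  LinearMap.mkContinuous
    { toFun := fun a => rep p a ξ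
      map_add' := fun a b => by simp
      map_smul' := fun c a => by simp } ‖ξ‖ fun a => by
    rw [mul_comm]
    exact (rep p a).le_of_opNorm_le (norm_rep_le p a) ξ

theorem evalCLM_apply (p : Idx R) (ξ : p.1.1) (a : SymPF R) : evalCLM p ξ a = rep p a ξ := rfl

variable (R) in
/-- The canonical map `L¹(G) → F*_R(G)`. -/
def of : L1 G →ₗ[ℂ] SymPF R where
  toFun f := (⟨toOps R f, subset_closure ⟨f, rfl⟩⟩ : symPFSubalgebra R)
  map_add' f g := Subtype.ext (map_add (toOps R) f g)
  map_smul' c f := Subtype.ext (map_smul (toOps R) c f)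

theorem rep_of (p : Idx R) (f : L1 G) : rep p (of R f) = integrated p.1.2 f := rfl

theorem norm_of_le (f : L1 G) : ‖of R f‖ ≤ ‖f‖ := norm_toOps_le R f

theorem dense_image_of : Dense (of R '' {f | IsCc f}) := by
  intro a
  have ha := closure_range_toOps_subset (show symPFSubalgebra R from a).2
  rw [Metric.mem_closure_iff] at ha ⊢
  intro ε hε
  obtain ⟨_, ⟨f, hf, rfl⟩, h⟩ := ha ε hε
  exact ⟨_, ⟨f, hf, rfl⟩, h⟩

theorem denseRange_of : DenseRange (of R) :=
  dense_image_of.mono (Set.image_subset_range _ _)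

/-- Left translation `a ↦ δₛ a`. -/
def leftShift (s : G) : SymPF R →L[ℂ] SymPF R :=
  LinearMap.mkContinuous
    { toFun := fun a => (⟨deltaOp R s * a.ops, deltaOp_mul_mem s a.2⟩ : symPFSubalgebra R)
      map_add' := fun a b => Subtype.ext (mul_add _ a.ops b.ops)
      map_smul' := fun c a => Subtype.ext (mul_smul_comm c _ a.ops) } 1 fun a => by
    refine (norm_mul_le (deltaOp R s) a.ops).trans ?_
    exact mul_le_mul_of_nonneg_right (norm_deltaOp_le s) (norm_nonneg _)

/-- Right translation `a ↦ a δₛ`. -/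
def rightShift (s : G) : SymPF R →L[ℂ] SymPF R :=
  LinearMap.mkContinuous
    { toFun := fun a => (⟨a.ops * deltaOp R s, mul_deltaOp_mem s a.2⟩ : symPFSubalgebra R)
      map_add' := fun a b => Subtype.ext (add_mul a.ops b.ops _)
      map_smul' := fun c a => Subtype.ext (smul_mul_assoc c a.ops _) } 1 fun a => by
    refine (norm_mul_le a.ops (deltaOp R s)).trans ?_
    rw [mul_comm]
    exact mul_le_mul_of_nonneg_right (norm_deltaOp_le s) (norm_nonneg _)

theorem ops_leftShift (s : G) (a : SymPF R) : (leftShift s a).ops = deltaOp R s * a.ops := rfl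

theorem ops_rightShift (s : G) (a : SymPF R) : (rightShift s a).ops = a.ops * deltaOp R s := rfl

theorem norm_leftShift_le (s : G) : ‖(leftShift s : SymPF R →L[ℂ] SymPF R)‖ ≤ 1 :=
  LinearMap.mkContinuous_norm_le _ zero_le_one _

theorem norm_rightShift_le (s : G) : ‖(rightShift s : SymPF R →L[ℂ] SymPF R)‖ ≤ 1 :=
  LinearMap.mkContinuous_norm_le _ zero_le_one _

theorem leftShift_mul (s t : G) (a : SymPF R) :
    leftShift (s * t) a = leftShift s (leftShift t a) :=
  ops_injective (by simp only [ops_leftShift, deltaOp_mul, mul_assoc])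

theorem rightShift_mul (s t : G) (a : SymPF R) :
    rightShift (s * t) a = rightShift t (rightShift s a) :=
  ops_injective (by simp only [ops_rightShift, deltaOp_mul, mul_assoc])

theorem leftShift_one (a : SymPF R) : leftShift 1 a = a :=
  ops_injective (deltaOp_one_mul a.ops)

theorem rightShift_one (a : SymPF R) : rightShift 1 a = a :=
  ops_injective (mul_deltaOp_one a.ops)

theorem rep_leftShift (p : Idx R) (s : G) (a : SymPF R) (ξ : p.1.1) :
    rep p (leftShift s a) ξ = p.1.2.toHom s (rep p a ξ) := rfl

theorem rep_rightShift (p : Idx R) (s : G) (a : SymPF R) (ξ : p.1.1) :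
    rep p (rightShift s a) ξ = rep p a (p.1.2.toHom s ξ) := rfl

theorem leftShift_of {g : G → ℂ} (hg : Continuous g) (hgs : HasCompactSupport g) (s : G) :
    leftShift s (of R (ccL1 g hg hgs)) = of R (ccL1 (leftTrans s g)
      (continuous_leftTrans hg s) (hasCompactSupport_leftTrans hgs s)) :=
  ops_injective (deltaOp_mul_toOps hg hgs s)

theorem rightShift_of {g : G → ℂ} (hg : Continuous g) (hgs : HasCompactSupport g) (s : G) :
    rightShift s (of R (ccL1 g hg hgs)) = of R (ccL1 (rightTrans s g)
      (continuous_rightTrans hg s) (hasCompactSupport_rightTrans hgs s)) :=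
  ops_injective (toOps_mul_deltaOp hg hgs s)

variable (R) in
/-- The multiplier `δₛ` of `F*_R(G)`. -/
def delta (s : G) : 𝓜(ℂ, SymPF R) where
  fst := leftShift s
  snd := rightShift s
  central a b := ops_injective (by
    simp only [ops_mul, ops_leftShift, ops_rightShift, mul_assoc])

theorem continuous_of : Continuous (of R) :=
  AddMonoidHomClass.continuous_of_bound (of R) 1 fun f => by simpa using norm_of_le f

theorem dense_span_image_of :
    Dense (Submodule.span ℂ (of R '' {f | IsCc f}) : Set (SymPF R)) :=
  dense_image_of.mono Submodule.subset_span

theorem continuous_leftShift (a : SymPF R) : Continuous fun s : G => leftShift s a := by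
  refine continuous_apply_of_dense_span norm_leftShift_le dense_span_image_of ?_ a
  rintro _ ⟨f, hf, rfl⟩
  obtain ⟨g, hg, hgs, rfl⟩ := IsCc.exists_eq_ccL1 hf
  simp only [leftShift_of]
  exact continuous_of.comp (continuous_of_ae_eq_family (continuous_leftTrans_uncurry hg)
    (exists_compact_leftTrans hgs) fun s => coeFn_ccL1 _ _)

theorem continuous_rightShift (a : SymPF R) : Continuous fun s : G => rightShift s a := by
  refine continuous_apply_of_dense_span norm_rightShift_le dense_span_image_of ?_ a
  rintro _ ⟨f, hf, rfl⟩
  obtain ⟨g, hg, hgs, rfl⟩ := IsCc.exists_eq_ccL1 hf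
  simp only [rightShift_of]
  exact continuous_of.comp (continuous_of_ae_eq_family (continuous_rightTrans_uncurry hg)
    (exists_compact_rightTrans hgs) fun s => coeFn_ccL1 _ _)

theorem continuous_delta :
    @Continuous G 𝓜(ℂ, SymPF R) _ (strictTopology (SymPF R)) (delta R) :=
  continuous_induced_rng.2 (continuous_pi fun a =>
    (continuous_leftShift a).prodMk (continuous_rightShift a))

/-- `g * a = ∫ g(s) δₛ a ds`. -/
theorem of_mul_eq_integral {g : G → ℂ} (hg : Continuous g) (hgs : HasCompactSupport g)
    (a : SymPF R) :
    of R (ccL1 g hg hgs) * a = ∫ s, g s • leftShift s a ∂Measure.haar := by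
  refine ext_rep fun p ξ => ?_
  rw [← evalCLM_apply p ξ (∫ s, _ ∂_), ← ContinuousLinearMap.integral_comp_comm _
    (integrable_smul_of_cc hg hgs (continuous_leftShift a))]
  rw [map_mul, rep_of]
  refine (integrated_ccL1 p.1.2 hg hgs (rep p a ξ)).trans ?_
  simp only [map_smul, evalCLM_apply, rep_leftShift]

/-- `a * g = ∫ g(s) a δₛ ds`. -/
theorem mul_of_eq_integral {g : G → ℂ} (hg : Continuous g) (hgs : HasCompactSupport g)
    (a : SymPF R) :
    a * of R (ccL1 g hg hgs) = ∫ s, g s • rightShift s a ∂Measure.haar := by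
  refine ext_rep fun p ξ => ?_
  rw [← evalCLM_apply p ξ (∫ s, _ ∂_), ← ContinuousLinearMap.integral_comp_comm _
    (integrable_smul_of_cc hg hgs (continuous_rightShift a))]
  rw [map_mul, rep_of]
  refine (congrArg (rep p a) (integrated_ccL1 p.1.2 hg hgs ξ)).trans ?_
  rw [← ContinuousLinearMap.integral_comp_comm _
    (integrable_smul_of_cc hg hgs (p.1.2.continuous_orbit ξ))]
  simp only [map_smul, evalCLM_apply, rep_rightShift]

/-! ### The approximate unit -/

variable (R) in
/-- The classes of the probability densities supported in `U`. -/
def bumps (U : Set G) : Set (SymPF R) :=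
  {e | ∃ (g : G → ℂ) (h : IsBump U g), e = of R (ccL1 g h.continuous h.hasCompactSupport)}

theorem monotone_bumps : Monotone (bumps (G := G) R) := by
  rintro U V hUV _ ⟨g, h, rfl⟩
  exact ⟨g, h.mono hUV, rfl⟩

variable (R) in
/-- The filter of probability densities concentrating at the identity. -/
def bumpFilter : Filter (SymPF R) := (𝓝 (1 : G)).lift' (bumps R)

instance : (bumpFilter R).NeBot := by
  refine (lift'_neBot_iff monotone_bumps).2 fun U hU => ?_
  obtain ⟨g, hg⟩ := exists_isBump hU
  exact ⟨_, g, hg, rfl⟩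

theorem eventually_bumpFilter {P : SymPF R → Prop} {U : Set G} (hU : U ∈ 𝓝 (1 : G))
    (h : ∀ e ∈ bumps R U, P e) : ∀ᶠ e in bumpFilter R, P e :=
  mem_of_superset (mem_lift' hU) h

theorem eventually_norm_le_one : ∀ᶠ e in bumpFilter R, ‖e‖ ≤ 1 := by
  refine eventually_bumpFilter univ_mem ?_
  rintro _ ⟨g, h, rfl⟩
  refine (norm_of_le _).trans (le_of_eq ?_)
  rw [L1.norm_eq_integral_norm, ← h.integral_norm]
  refine integral_congr_ae ?_
  filter_upwards [coeFn_ccL1 h.continuous h.hasCompactSupport] with x hx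
  rw [hx]

theorem isApproximateUnit_bumpFilter : (bumpFilter R).IsApproximateUnit := by
  have key : ∀ (c : G → SymPF R), Continuous c → ∀ a, c 1 = a → ∀ ε > 0, ∃ U ∈ 𝓝 (1 : G),
      ∀ s ∈ U, ‖c s - a‖ ≤ ε := by
    rintro c hc _ rfl ε hε
    refine ⟨_, hc.continuousAt (Metric.closedBall_mem_nhds _ hε), fun s hs => ?_⟩
    rw [← dist_eq_norm]
    exact hs
  constructor
  · intro a
    rw [Metric.nhds_basis_closedBall.tendsto_right_iff]
    intro ε hε
    obtain ⟨U, hU, h⟩ := key _ (continuous_rightShift a) a (rightShift_one a) ε hε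
    refine eventually_bumpFilter hU ?_
    rintro _ ⟨g, hg, rfl⟩
    rw [mul_of_eq_integral, Metric.mem_closedBall, dist_eq_norm]
    exact hg.norm_integral_smul_sub_le (continuous_rightShift a) h
  · intro a
    rw [Metric.nhds_basis_closedBall.tendsto_right_iff]
    intro ε hε
    obtain ⟨U, hU, h⟩ := key _ (continuous_leftShift a) a (leftShift_one a) ε hε
    refine eventually_bumpFilter hU ?_
    rintro _ ⟨g, hg, rfl⟩
    rw [of_mul_eq_integral, Metric.mem_closedBall, dist_eq_norm]
    exact hg.norm_integral_smul_sub_le (continuous_leftShift a) h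

theorem hasBoundedApproximateUnit : HasBoundedApproximateUnit (SymPF R) :=
  ⟨bumpFilter R, isApproximateUnit_bumpFilter, 1, eventually_norm_le_one⟩

end SymPF

end Translations

/-! ### Multipliers acting on essential bimodules -/

namespace Bimodule

section General

variable {A : Type w} [NonUnitalNormedRing A] [NormedSpace ℂ A] [IsScalarTower ℂ A A]
  [SMulCommClass ℂ A A] {E : BanachSp.{u}} {M : Bimodule A E} {l : Filter A} {C : ℝ}

theorem continuous_left_apply (M : Bimodule A E) (ξ : E) : Continuous fun a => M.left a ξ :=
  (ContinuousLinearMap.apply ℂ E ξ).continuous.comp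
    (AddMonoidHomClass.continuous_of_bound M.left 1 fun a => by simpa using M.norm_left_le a)

theorem continuous_right_apply (M : Bimodule A E) (ξ : E) :
    Continuous fun a => M.right (MulOpposite.op a) ξ :=
  (ContinuousLinearMap.apply ℂ E ξ).continuous.comp
    ((AddMonoidHomClass.continuous_of_bound M.right 1
      fun a => by simpa using M.norm_right_le a).comp MulOpposite.continuous_op)

theorem left_mul_apply (a b : A) (ξ : E) : M.left (a * b) ξ = M.left a (M.left b ξ) := by
  rw [map_mul]
  rfl

theorem right_mul_apply (a b : A) (ξ : E) : M.right (MulOpposite.op (a * b)) ξ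
    = M.right (MulOpposite.op b) (M.right (MulOpposite.op a) ξ) := by
  rw [MulOpposite.op_mul, map_mul]
  rfl

theorem left_right_apply (a : A) (b : Aᵐᵒᵖ) (ξ : E) :
    M.left a (M.right b ξ) = M.right b (M.left a ξ) :=
  DFunLike.congr_fun (M.commute a b) ξ

theorem tendsto_left (h : M.IsEssential) (hl : l.IsApproximateUnit) (hC : ∀ᶠ e in l, ‖e‖ ≤ C)
    (ζ : E) : Tendsto (fun e => M.left e ζ) l (𝓝 ζ) := by
  have := hl.neBot
  have hlim : ∀ (a : A) (ξ : E), Tendsto (fun e => M.left e (M.left a ξ)) l (𝓝 (M.left a ξ)) := by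
    intro a ξ
    simp only [← left_mul_apply]
    exact (M.continuous_left_apply ξ).continuousAt.tendsto.comp (hl.tendsto_mul_right a)
  obtain ⟨S, hS⟩ := exists_limit_operator (l := l) (fun e => M.left e) (C := C)
    (by filter_upwards [hC] with e he using (M.norm_left_le e).trans he) _ h.dense_left (by
      rintro _ ⟨a, ξ, rfl⟩
      exact ⟨_, hlim a ξ⟩)
  have hS1 : S = ContinuousLinearMap.id ℂ E := by
    refine ContinuousLinearMap.ext_on h.dense_left ?_
    rintro _ ⟨a, ξ, rfl⟩
    exact tendsto_nhds_unique (hS _) (hlim a ξ)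
  simpa [hS1] using hS ζ

theorem tendsto_right (h : M.IsEssential) (hl : l.IsApproximateUnit) (hC : ∀ᶠ e in l, ‖e‖ ≤ C)
    (ζ : E) : Tendsto (fun e => M.right (MulOpposite.op e) ζ) l (𝓝 ζ) := by
  have := hl.neBot
  have hlim : ∀ (a : A) (ξ : E), Tendsto
      (fun e => M.right (MulOpposite.op e) (M.right (MulOpposite.op a) ξ)) l
      (𝓝 (M.right (MulOpposite.op a) ξ)) := by
    intro a ξ
    simp only [← right_mul_apply]
    exact (M.continuous_right_apply ξ).continuousAt.tendsto.comp (hl.tendsto_mul_left a)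
  obtain ⟨S, hS⟩ := exists_limit_operator (l := l) (fun e => M.right (MulOpposite.op e)) (C := C)
    (by filter_upwards [hC] with e he using (M.norm_right_le _).trans he) _ h.dense_right (by
      rintro _ ⟨a, ξ, rfl⟩
      exact ⟨_, hlim a ξ⟩)
  have hS1 : S = ContinuousLinearMap.id ℂ E := by
    refine ContinuousLinearMap.ext_on h.dense_right ?_
    rintro _ ⟨a, ξ, rfl⟩
    exact tendsto_nhds_unique (hS _) (hlim a ξ)
  simpa [hS1] using hS ζ

theorem norm_multLeft_le (h : M.IsEssential) (hl : l.IsApproximateUnit)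
    (hC : ∀ᶠ e in l, ‖e‖ ≤ C) (x : 𝓜(ℂ, A)) : ‖M.multLeft x‖ ≤ ‖x.fst‖ * C := by
  have := hl.neBot
  have hC0 : 0 ≤ C := by
    obtain ⟨e, he⟩ := hC.exists
    exact (norm_nonneg e).trans he
  refine ContinuousLinearMap.opNorm_le_bound _ (by positivity) fun ζ => ?_
  refine le_of_tendsto
    (((M.multLeft x).continuous.tendsto ζ).comp (tendsto_left h hl hC ζ)).norm ?_
  filter_upwards [hC] with e he
  rw [Function.comp_apply, multLeft_apply ⟨l, hl, C, hC⟩ h]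
  exact (M.left _).le_of_opNorm_le
    ((M.norm_left_le _).trans ((x.fst.le_opNorm e).trans (by gcongr))) ζ

theorem norm_multRight_le (h : M.IsEssential) (hl : l.IsApproximateUnit)
    (hC : ∀ᶠ e in l, ‖e‖ ≤ C) (x : 𝓜(ℂ, A)) : ‖M.multRight x‖ ≤ ‖x.snd‖ * C := by
  have := hl.neBot
  have hC0 : 0 ≤ C := by
    obtain ⟨e, he⟩ := hC.exists
    exact (norm_nonneg e).trans he
  refine ContinuousLinearMap.opNorm_le_bound _ (by positivity) fun ζ => ?_
  refine le_of_tendsto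
    (((M.multRight x).continuous.tendsto ζ).comp (tendsto_right h hl hC ζ)).norm ?_
  filter_upwards [hC] with e he
  rw [Function.comp_apply, multRight_apply ⟨l, hl, C, hC⟩ h]
  exact (M.right _).le_of_opNorm_le
    ((M.norm_right_le _).trans ((x.snd.le_opNorm e).trans (by gcongr))) ζ

theorem multLeft_right (hA : HasBoundedApproximateUnit A) (h : M.IsEssential) (x : 𝓜(ℂ, A))
    (b : Aᵐᵒᵖ) (ξ : E) : M.multLeft x (M.right b ξ) = M.right b (M.multLeft x ξ) := by
  have : (M.multLeft x).comp (M.right b) = (M.right b).comp (M.multLeft x) := by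
    refine ContinuousLinearMap.ext_on h.dense_left ?_
    rintro _ ⟨a, ξ, rfl⟩
    simp only [ContinuousLinearMap.comp_apply, ← left_right_apply, multLeft_apply hA h]
  exact DFunLike.congr_fun this ξ

theorem multLeft_multRight (hA : HasBoundedApproximateUnit A) (h : M.IsEssential)
    (x y : 𝓜(ℂ, A)) (ξ : E) :
    M.multLeft x (M.multRight y ξ) = M.multRight y (M.multLeft x ξ) := by
  have : (M.multLeft x).comp (M.multRight y) = (M.multRight y).comp (M.multLeft x) := by
    refine ContinuousLinearMap.ext_on h.dense_right ?_
    rintro _ ⟨a, ξ, rfl⟩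
    simp only [ContinuousLinearMap.comp_apply, multLeft_right hA h, multRight_apply hA h]
  exact DFunLike.congr_fun this ξ

/-- `a · (x · ξ) = R(a) · ξ` for a multiplier `x = (L, R)`. -/
theorem left_multLeft (hA : HasBoundedApproximateUnit A) (h : M.IsEssential) (x : 𝓜(ℂ, A))
    (a : A) (ξ : E) : M.left a (M.multLeft x ξ) = M.left (x.snd a) ξ := by
  have : (M.left a).comp (M.multLeft x) = M.left (x.snd a) := by
    refine ContinuousLinearMap.ext_on h.dense_left ?_
    rintro _ ⟨b, ξ, rfl⟩
    simp only [ContinuousLinearMap.comp_apply, multLeft_apply hA h, ← left_mul_apply, x.central]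
  exact DFunLike.congr_fun this ξ

/-- `(ξ · x) · b = ξ · L(b)` for a multiplier `x = (L, R)`. -/
theorem right_multRight (hA : HasBoundedApproximateUnit A) (h : M.IsEssential) (x : 𝓜(ℂ, A))
    (b : A) (ξ : E) : M.right (MulOpposite.op b) (M.multRight x ξ)
      = M.right (MulOpposite.op (x.fst b)) ξ := by
  have : (M.right (MulOpposite.op b)).comp (M.multRight x)
      = M.right (MulOpposite.op (x.fst b)) := by
    refine ContinuousLinearMap.ext_on h.dense_right ?_
    rintro _ ⟨c, ξ, rfl⟩
    simp only [ContinuousLinearMap.comp_apply, multRight_apply hA h, ← right_mul_apply, x.central]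
  exact DFunLike.congr_fun this ξ

theorem eq_of_left_eq (h : M.IsEssential) (hA : HasBoundedApproximateUnit A) {ξ η : E}
    (H : ∀ a, M.left a ξ = M.left a η) : ξ = η := by
  obtain ⟨l, hl, C, hC⟩ := hA
  have := hl.neBot
  refine tendsto_nhds_unique (tendsto_left h hl hC ξ) ?_
  simp only [H]
  exact tendsto_left h hl hC η

theorem eq_of_right_eq (h : M.IsEssential) (hA : HasBoundedApproximateUnit A) {ξ η : E}
    (H : ∀ a, M.right (MulOpposite.op a) ξ = M.right (MulOpposite.op a) η) : ξ = η := by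
  obtain ⟨l, hl, C, hC⟩ := hA
  have := hl.neBot
  refine tendsto_nhds_unique (tendsto_right h hl hC ξ) ?_
  simp only [H]
  exact tendsto_right h hl hC η

end General

/-! ### The conjugation representation of an essential bimodule -/

section Conj

variable {G : Type v} [Group G] [TopologicalSpace G] [IsTopologicalGroup G]
  [LocallyCompactSpace G] [T2Space G] [MeasurableSpace G] [BorelSpace G]
  {R : ∀ E : BanachSp.{u}, IsomRep G E → Prop} {E : BanachSp.{u}} {M : Bimodule (SymPF R) E}

open SymPF

variable (M) in
/-- The action `ξ ↦ δₛ · ξ` of the multiplier `δₛ` on an essential bimodule. -/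
def deltaLeft (s : G) : E →L[ℂ] E := M.multLeft (delta R s)

variable (M) in
/-- The action `ξ ↦ ξ · δₛ` of the multiplier `δₛ` on an essential bimodule. -/
def deltaRight (s : G) : E →L[ℂ] E := M.multRight (delta R s)

theorem deltaLeft_left (h : M.IsEssential) (s : G) (a : SymPF R) (ξ : E) :
    M.deltaLeft s (M.left a ξ) = M.left (leftShift s a) ξ :=
  multLeft_apply hasBoundedApproximateUnit h _ a ξ

theorem deltaRight_right (h : M.IsEssential) (s : G) (a : SymPF R) (ξ : E) :
    M.deltaRight s (M.right (MulOpposite.op a) ξ) = M.right (MulOpposite.op (rightShift s a)) ξ :=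
  multRight_apply hasBoundedApproximateUnit h _ a ξ

theorem deltaLeft_deltaRight (h : M.IsEssential) (s t : G) (ξ : E) :
    M.deltaLeft s (M.deltaRight t ξ) = M.deltaRight t (M.deltaLeft s ξ) :=
  multLeft_multRight hasBoundedApproximateUnit h _ _ ξ

theorem norm_deltaLeft_le (h : M.IsEssential) (s : G) : ‖M.deltaLeft s‖ ≤ 1 := by
  refine (norm_multLeft_le h isApproximateUnit_bumpFilter eventually_norm_le_one _).trans ?_
  rw [mul_one]
  exact norm_leftShift_le s

theorem norm_deltaRight_le (h : M.IsEssential) (s : G) : ‖M.deltaRight s‖ ≤ 1 := by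
  refine (norm_multRight_le h isApproximateUnit_bumpFilter eventually_norm_le_one _).trans ?_
  rw [mul_one]
  exact norm_rightShift_le s

theorem deltaLeft_mul (h : M.IsEssential) (s t : G) (ξ : E) :
    M.deltaLeft (s * t) ξ = M.deltaLeft s (M.deltaLeft t ξ) := by
  have : M.deltaLeft (s * t) = (M.deltaLeft s).comp (M.deltaLeft t) := by
    refine ContinuousLinearMap.ext_on h.dense_left ?_
    rintro _ ⟨a, ξ, rfl⟩
    simp only [ContinuousLinearMap.comp_apply, deltaLeft_left h, leftShift_mul]
  exact DFunLike.congr_fun this ξ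

theorem deltaRight_mul (h : M.IsEssential) (s t : G) (ξ : E) :
    M.deltaRight (s * t) ξ = M.deltaRight t (M.deltaRight s ξ) := by
  have : M.deltaRight (s * t) = (M.deltaRight t).comp (M.deltaRight s) := by
    refine ContinuousLinearMap.ext_on h.dense_right ?_
    rintro _ ⟨a, ξ, rfl⟩
    simp only [ContinuousLinearMap.comp_apply, deltaRight_right h, rightShift_mul]
  exact DFunLike.congr_fun this ξ

theorem deltaLeft_one (h : M.IsEssential) (ξ : E) : M.deltaLeft 1 ξ = ξ := by
  have : M.deltaLeft 1 = ContinuousLinearMap.id ℂ E := by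
    refine ContinuousLinearMap.ext_on h.dense_left ?_
    rintro _ ⟨a, ξ, rfl⟩
    simp only [ContinuousLinearMap.id_apply, deltaLeft_left h, leftShift_one]
  exact DFunLike.congr_fun this ξ

theorem deltaRight_one (h : M.IsEssential) (ξ : E) : M.deltaRight 1 ξ = ξ := by
  have : M.deltaRight 1 = ContinuousLinearMap.id ℂ E := by
    refine ContinuousLinearMap.ext_on h.dense_right ?_
    rintro _ ⟨a, ξ, rfl⟩
    simp only [ContinuousLinearMap.id_apply, deltaRight_right h, rightShift_one]
  exact DFunLike.congr_fun this ξ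

theorem continuous_deltaLeft (h : M.IsEssential) (ξ : E) :
    Continuous fun s => M.deltaLeft s ξ := by
  refine continuous_apply_of_dense_span (norm_deltaLeft_le h) h.dense_left ?_ ξ
  rintro _ ⟨a, ξ, rfl⟩
  simp only [deltaLeft_left h]
  exact (M.continuous_left_apply ξ).comp (continuous_leftShift a)

theorem continuous_deltaRight (h : M.IsEssential) (ξ : E) :
    Continuous fun s => M.deltaRight s ξ := by
  refine continuous_apply_of_dense_span (norm_deltaRight_le h) h.dense_right ?_ ξ
  rintro _ ⟨a, ξ, rfl⟩
  simp only [deltaRight_right h]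
  exact (M.continuous_right_apply ξ).comp (continuous_rightShift a)

variable (M) in
/-- The representation `ξ ↦ δₛ · ξ · δₛ⁻¹` of `G` on an essential `F*_R(G)`-bimodule. -/
def conjRep (h : M.IsEssential) : IsomRep G E :=
  IsomRep.ofContractive (fun s => (M.deltaLeft s).comp (M.deltaRight s⁻¹))
    (ContinuousLinearMap.ext fun ξ => by
      simp [deltaLeft_one h, deltaRight_one h])
    (fun s t => ContinuousLinearMap.ext fun ξ => by
      change M.deltaLeft (s * t) (M.deltaRight (s * t)⁻¹ ξ)
        = M.deltaLeft s (M.deltaRight s⁻¹ (M.deltaLeft t (M.deltaRight t⁻¹ ξ)))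
      rw [mul_inv_rev, deltaLeft_mul h, deltaRight_mul h, deltaLeft_deltaRight h t])
    (fun s => by
      refine (ContinuousLinearMap.opNorm_comp_le _ _).trans ?_
      exact mul_le_one₀ (norm_deltaLeft_le h s) (norm_nonneg _) (norm_deltaRight_le h s⁻¹))
    (fun ξ => continuous_apply_apply (norm_deltaLeft_le h) (continuous_deltaLeft h)
      ((continuous_deltaRight h ξ).comp continuous_inv))

theorem conjRep_apply (h : M.IsEssential) (s : G) (ξ : E) :
    (M.conjRep h).toHom s ξ = M.deltaLeft s (M.deltaRight s⁻¹ ξ) := rfl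

theorem deltaRight_conjRep (h : M.IsEssential) (s : G) (ξ : E) :
    M.deltaRight s ((M.conjRep h).toHom s ξ) = M.deltaLeft s ξ := by
  rw [conjRep_apply, ← deltaLeft_deltaRight h, ← deltaRight_mul h, inv_mul_cancel,
    deltaRight_one h]

theorem norm_conjRep_sub_le (h : M.IsEssential) (s : G) (ξ : E) :
    ‖(M.conjRep h).toHom s ξ - ξ‖ ≤ ‖M.deltaLeft s ξ - M.deltaRight s ξ‖ := by
  have : (M.conjRep h).toHom s ξ - ξ
      = M.deltaRight s⁻¹ (M.deltaLeft s ξ - M.deltaRight s ξ) := by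
    rw [map_sub, ← deltaRight_mul h, mul_inv_cancel, deltaRight_one h, conjRep_apply,
      deltaLeft_deltaRight h]
  rw [this]
  simpa using (M.deltaRight s⁻¹).le_of_opNorm_le (norm_deltaRight_le h s⁻¹)
    (M.deltaLeft s ξ - M.deltaRight s ξ)

/-- `g · ξ = ∫ g(s) δₛ · ξ ds`. -/
theorem left_of_eq_integral (h : M.IsEssential) {g : G → ℂ} (hg : Continuous g)
    (hgs : HasCompactSupport g) (ξ : E) :
    M.left (of R (ccL1 g hg hgs)) ξ = ∫ s, g s • M.deltaLeft s ξ ∂Measure.haar := by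
  refine eq_of_left_eq h hasBoundedApproximateUnit fun a => ?_
  rw [← ContinuousLinearMap.integral_comp_comm _
    (integrable_smul_of_cc hg hgs (continuous_deltaLeft h ξ)), ← left_mul_apply,
    mul_of_eq_integral]
  let Φ : SymPF R →L[ℂ] E := LinearMap.mkContinuous
    { toFun := fun a => M.left a ξ
      map_add' := fun a b => by simp
      map_smul' := fun c a => by simp } ‖ξ‖ fun a => by
    rw [mul_comm]
    exact (M.left a).le_of_opNorm_le (M.norm_left_le a) ξ
  refine (Φ.integral_comp_comm
    (integrable_smul_of_cc hg hgs (continuous_rightShift a))).symm.trans ?_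
  refine integral_congr_ae (Eventually.of_forall fun s => ?_)
  simp only [map_smul]
  exact congrArg (g s • ·) (left_multLeft hasBoundedApproximateUnit h (delta R s) a ξ).symm

/-- `ξ · g = ∫ g(s) ξ · δₛ ds`. -/
theorem right_of_eq_integral (h : M.IsEssential) {g : G → ℂ} (hg : Continuous g)
    (hgs : HasCompactSupport g) (ξ : E) :
    M.right (MulOpposite.op (of R (ccL1 g hg hgs))) ξ
      = ∫ s, g s • M.deltaRight s ξ ∂Measure.haar := by
  refine eq_of_right_eq h hasBoundedApproximateUnit fun a => ?_
  rw [← ContinuousLinearMap.integral_comp_comm _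
    (integrable_smul_of_cc hg hgs (continuous_deltaRight h ξ)), ← right_mul_apply,
    of_mul_eq_integral]
  let Φ : SymPF R →L[ℂ] E := LinearMap.mkContinuous
    { toFun := fun a => M.right (MulOpposite.op a) ξ
      map_add' := fun a b => by simp
      map_smul' := fun c a => by simp } ‖ξ‖ fun a => by
    rw [mul_comm]
    exact (M.right _).le_of_opNorm_le (M.norm_right_le (MulOpposite.op a)) ξ
  refine (Φ.integral_comp_comm
    (integrable_smul_of_cc hg hgs (continuous_leftShift a))).symm.trans ?_
  refine integral_congr_ae (Eventually.of_forall fun s => ?_)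
  simp only [map_smul]
  exact congrArg (g s • ·) (right_multRight hasBoundedApproximateUnit h (delta R s) a ξ).symm

/-- A vector invariant under the conjugation representation is central. -/
theorem isCentral_of_isInvariant (h : M.IsEssential) {ξ : E} (hξ : (M.conjRep h).IsInvariant ξ) :
    M.IsCentral ξ := by
  have heq : ∀ s, M.deltaLeft s ξ = M.deltaRight s ξ := fun s => by
    rw [← deltaRight_conjRep h, hξ s]
  have hclosed : IsClosed {a : SymPF R | M.left a ξ = M.right (MulOpposite.op a) ξ} :=
    isClosed_eq (M.continuous_left_apply ξ) (M.continuous_right_apply ξ)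
  refine fun a => hclosed.closure_subset_iff.2 ?_ (dense_image_of a)
  rintro _ ⟨f, hf, rfl⟩
  obtain ⟨g, hg, hgs, rfl⟩ := IsCc.exists_eq_ccL1 hf
  change _ = _
  rw [left_of_eq_integral h, right_of_eq_integral h]
  simp only [heq]

end Conj

end Bimodule

/-! ### From the group to the algebra -/

/-- Valid for the algebra of any class `R` of representations, whether or not it is related to
`𝓔`. -/
theorem GroupWeakPropertyT.weakPropertyT {G : Type v} [Group G] [TopologicalSpace G]
    [IsTopologicalGroup G] [LocallyCompactSpace G] [T2Space G] [MeasurableSpace G] [BorelSpace G]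
    {𝓔 : Set BanachSp.{u}} (hG : GroupWeakPropertyT G 𝓔)
    (R : ∀ E : BanachSp.{u}, IsomRep G E → Prop) : WeakPropertyT (SymPF R) 𝓔 := by
  refine ⟨SymPF.hasBoundedApproximateUnit, fun E hE M h => ?_⟩
  rintro ⟨I, _, _, _, ξ, hξ1, hξ⟩
  obtain ⟨η, hη0, hη⟩ := hG.exists_invariant hE (M.conjRep h) fun K hK ε hε => by
    -- `δ` is strictly continuous, so it maps `K` to a strictly compact set of multipliers.
    have hS : @IsCompact _ (strictTopology (SymPF R)) (SymPF.delta R '' K) :=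
      @IsCompact.image _ _ _ (strictTopology (SymPF R)) _ _ hK SymPF.continuous_delta
    obtain ⟨i, hi⟩ := hξ _ hS ε hε
    exact ⟨ξ i, hξ1 i, fun s hs => (Bimodule.norm_conjRep_sub_le h s (ξ i)).trans_lt
      (hi i le_rfl _ ⟨s, hs, rfl⟩)⟩
  exact ⟨η, hη0, Bimodule.isCentral_of_isInvariant h hη⟩

/-! ### The trivial character -/

/-- Equicontinuous linear maps that converge to zero on a dense set do so uniformly on compact
sets. -/
theorem eventually_forall_norm_lt_of_isCompact {A F I : Type*} [NormedAddCommGroup A]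
    [NormedSpace ℂ A] [NormedAddCommGroup F] [NormedSpace ℂ F] {l : Filter I}
    {T : I → A →L[ℂ] F} {C : ℝ} (hC : ∀ i, ‖T i‖ ≤ C) {D : Set A} (hD : Dense D)
    (hT : ∀ a ∈ D, Tendsto (fun i => T i a) l (𝓝 0)) {Q : Set A} (hQ : IsCompact Q) {ε : ℝ}
    (hε : 0 < ε) : ∀ᶠ i in l, ∀ a ∈ Q, ‖T i a‖ < ε := by
  refine hQ.induction_on (p := fun s => ∀ᶠ i in l, ∀ a ∈ s, ‖T i a‖ < ε) ?_ ?_ ?_ ?_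
  · simp
  · exact fun s t hst h => h.mono fun i hi a ha => hi a (hst ha)
  · intro s t hs ht
    filter_upwards [hs, ht] with i h1 h2 a ha
    exact ha.elim (h1 a) (h2 a)
  · intro x _
    have hδ : 0 < ε / (2 * (|C| + 1)) := by positivity
    obtain ⟨d, hd, hdD⟩ := Metric.dense_iff.1 hD x _ hδ
    refine ⟨Metric.ball d (ε / (2 * (|C| + 1))), mem_nhdsWithin_of_mem_nhds
      (Metric.isOpen_ball.mem_nhds (Metric.mem_ball_comm.1 hd)), ?_⟩
    filter_upwards [Metric.tendsto_nhds.1 (hT d hdD) (ε / 2) (half_pos hε)] with i hi a ha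
    rw [dist_zero_right] at hi
    rw [Metric.mem_ball, dist_eq_norm] at ha
    have h1 : ‖T i (a - d)‖ ≤ ε / 2 := by
      refine ((T i).le_of_opNorm_le ((hC i).trans (le_abs_self C)) _).trans ?_
      calc |C| * ‖a - d‖ ≤ (|C| + 1) * (ε / (2 * (|C| + 1))) := by
            gcongr
            linarith
        _ = ε / 2 := by field_simp
    calc ‖T i a‖ = ‖T i (a - d) + T i d‖ := by rw [← map_add, sub_add_cancel]
      _ ≤ ‖T i (a - d)‖ + ‖T i d‖ := norm_add_le _ _
      _ < ε := by linarith

section Character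

variable {G : Type v} [Group G] [TopologicalSpace G] [IsTopologicalGroup G]
  [LocallyCompactSpace G] [T2Space G] [MeasurableSpace G] [BorelSpace G]
  {R : ∀ E : BanachSp.{u}, IsomRep G E → Prop}

variable (G) in
/-- The integral as a linear functional on `L¹(G)`. -/
def integralL1 : L1 G →ₗ[ℂ] ℂ where
  toFun f := ∫ s, f s ∂Measure.haar
  map_add' f g := by
    rw [← integral_add (L1.integrable_coeFn f) (L1.integrable_coeFn g)]
    exact integral_congr_ae (Lp.coeFn_add f g)
  map_smul' c f := by
    rw [RingHom.id_apply, ← integral_smul]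
    exact integral_congr_ae (Lp.coeFn_smul c f)

theorem integralL1_ccL1 {g : G → ℂ} (hg : Continuous g) (hgs : HasCompactSupport g) :
    integralL1 G (ccL1 g hg hgs) = ∫ s, g s ∂Measure.haar :=
  integral_congr_ae (coeFn_ccL1 hg hgs)

theorem dense_setOf_isCc : Dense {f : L1 G | IsCc f} := by
  intro f
  rw [Metric.mem_closure_iff]
  intro ε hε
  obtain ⟨h, hc, hn⟩ := exists_isCc_near f (half_pos hε)
  exact ⟨h, hc, by rw [dist_eq_norm]; exact hn.trans_lt (half_lt_self hε)⟩

/-- A family of unit vectors that is almost invariant along the filter `l`, uniformly on compact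
sets. -/
structure IsomRep.HasAlmostInvariant {E : BanachSp.{u}} (π : IsomRep G E) {I : Type*}
    (l : Filter I) (ξ : I → E) : Prop where
  norm_eq_one : ∀ i, ‖ξ i‖ = 1
  eventually_lt : ∀ K : Set G, IsCompact K → ∀ ε : ℝ, 0 < ε →
    ∀ᶠ i in l, ∀ s ∈ K, ‖π.toHom s (ξ i) - ξ i‖ < ε

/-- For a representation `π` with an almost invariant net of unit vectors `ξᵢ`, and `g`
continuous with compact support, `π(g) ξᵢ` is asymptotically `(∫ g) ξᵢ`. -/
theorem tendsto_integrated_sub {E : BanachSp.{u}} (π : IsomRep G E) {I : Type*} {l : Filter I}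
    {ξ : I → E} (hξ : π.HasAlmostInvariant l ξ)
    {g : G → ℂ} (hg : Continuous g) (hgs : HasCompactSupport g) :
    Tendsto (fun i => integrated π (ccL1 g hg hgs) (ξ i)
      - (∫ s, g s ∂(Measure.haar : Measure G)) • ξ i) l (𝓝 0) := by
  rw [Metric.tendsto_nhds]
  intro ε hε
  have hC : 0 ≤ ∫ s, ‖g s‖ ∂(Measure.haar : Measure G) := integral_nonneg fun s => norm_nonneg _
  set C := ∫ s, ‖g s‖ ∂(Measure.haar : Measure G) with hCdef
  filter_upwards [hξ.eventually_lt _ hgs (ε / (C + 1)) (by positivity)] with i hi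
  rw [dist_zero_right, integrated_ccL1]
  refine (norm_integral_smul_sub_le hg hgs (π.continuous_orbit _)
    fun s hs => (hi s (subset_tsupport g hs)).le).trans_lt ?_
  rw [← hCdef, ← mul_div_assoc, div_lt_iff₀ (by positivity)]
  nlinarith

/-- A representation with almost invariant unit vectors weakly contains the trivial one. -/
theorem norm_integralL1_le {E : BanachSp.{u}} (π : IsomRep G E) {I : Type*} {l : Filter I}
    [l.NeBot] {ξ : I → E} (hξ : π.HasAlmostInvariant l ξ) (f : L1 G) :
    ‖integralL1 G f‖ ≤ ‖integrated π f‖ := by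
  have hcont : Continuous fun f : L1 G => integrated π f :=
    AddMonoidHomClass.continuous_of_bound
      (AddMonoidHom.mk' (integrated π) (integrated_add π)) 1 fun f => by
        simpa using norm_integrated_le π f
  have hcl : IsClosed {f : L1 G | ‖integralL1 G f‖ ≤ ‖integrated π f‖} :=
    isClosed_le (continuous_integral (μ := (Measure.haar : Measure G))).norm hcont.norm
  refine hcl.closure_subset_iff.2 ?_ (dense_setOf_isCc f)
  intro f hf
  obtain ⟨g, hg, hgs, rfl⟩ := IsCc.exists_eq_ccL1 hf
  rw [Set.mem_ofPred_eq, integralL1_ccL1]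
  have hlim := (tendsto_integrated_sub π hξ hg hgs).norm.const_add ‖integrated π (ccL1 g hg hgs)‖
  rw [norm_zero, add_zero] at hlim
  refine ge_of_tendsto' hlim fun i => ?_
  calc ‖∫ s, g s ∂(Measure.haar : Measure G)‖
      = ‖(∫ s, g s ∂(Measure.haar : Measure G)) • ξ i‖ := by rw [norm_smul, hξ.norm_eq_one, mul_one]
    _ = ‖integrated π (ccL1 g hg hgs) (ξ i) - (integrated π (ccL1 g hg hgs) (ξ i)
          - (∫ s, g s ∂(Measure.haar : Measure G)) • ξ i)‖ := by rw [sub_sub_cancel]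
    _ ≤ ‖integrated π (ccL1 g hg hgs) (ξ i)‖ + _ := norm_sub_le _ _
    _ ≤ _ := by
        gcongr
        simpa [hξ.norm_eq_one] using (integrated π (ccL1 g hg hgs)).le_opNorm (ξ i)

namespace SymPF

variable (R) in
/-- The extension of `f ↦ ∫ f` to `F*_R(G)`. It is meaningful if the integral is dominated by the
norm of `F*_R(G)`. -/
def trivChar : SymPF R →L[ℂ] ℂ := (integralL1 G).extendOfNorm (of R)


theorem norm_integralL1_le_norm_of {p : Idx R} {I : Type*} {l : Filter I} [l.NeBot]
    {ξ : I → p.1.1} (hξ : p.1.2.HasAlmostInvariant l ξ) (f : L1 G) :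
    ‖integralL1 G f‖ ≤ 1 * ‖of R f‖ := by
  rw [one_mul]
  exact (norm_integralL1_le p.1.2 hξ f).trans (norm_rep_le p (of R f))

section AlmostInvariant

variable {p : Idx R} {I : Type*} {l : Filter I} [l.NeBot] {ξ : I → p.1.1}

theorem trivChar_of (hξ : p.1.2.HasAlmostInvariant l ξ) (f : L1 G) :
    trivChar R (of R f) = ∫ s, f s ∂Measure.haar :=
  LinearMap.extendOfNorm_eq denseRange_of ⟨1, norm_integralL1_le_norm_of hξ⟩ f

theorem trivChar_of_ccL1 (hξ : p.1.2.HasAlmostInvariant l ξ) {g : G → ℂ} (hg : Continuous g)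
    (hgs : HasCompactSupport g) :
    trivChar R (of R (ccL1 g hg hgs)) = ∫ s, g s ∂Measure.haar :=
  (trivChar_of hξ _).trans (integralL1_ccL1 hg hgs)

theorem norm_trivChar_le (hξ : p.1.2.HasAlmostInvariant l ξ) (a : SymPF R) :
    ‖trivChar R a‖ ≤ ‖a‖ := by
  have h := LinearMap.norm_extendOfNorm_apply_le denseRange_of 1 (norm_integralL1_le_norm_of hξ) a
  rwa [one_mul] at h

/-- For `a ∈ F*_R(G)`, `π(a) ξᵢ - 1(a) ξᵢ` tends to `0`, uniformly on compact sets. -/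
theorem eventually_norm_rep_sub_lt (hξ : p.1.2.HasAlmostInvariant l ξ) {Q : Set (SymPF R)}
    (hQ : IsCompact Q) {ε : ℝ} (hε : 0 < ε) :
    ∀ᶠ i in l, ∀ a ∈ Q, ‖rep p a (ξ i) - trivChar R a • ξ i‖ < ε := by
  refine eventually_forall_norm_lt_of_isCompact (C := 2)
    (T := fun i => evalCLM p (ξ i) - (trivChar R).smulRight (ξ i)) (fun i => ?_)
    dense_image_of ?_ hQ hε
  · refine ContinuousLinearMap.opNorm_le_bound _ zero_le_two fun a => ?_
    refine (norm_sub_le _ _).trans ?_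
    have h1 := (rep p a).le_of_opNorm_le (norm_rep_le p a) (ξ i)
    have h2 := norm_trivChar_le hξ a
    have h3 : ‖(trivChar R).smulRight (ξ i) a‖ = ‖trivChar R a‖ := by
      rw [ContinuousLinearMap.smulRight_apply, norm_smul, hξ.norm_eq_one, mul_one]
    rw [hξ.norm_eq_one, mul_one, ← evalCLM_apply] at h1
    refine (add_le_add h1 (h3.le.trans h2)).trans (two_mul _).ge
  · rintro _ ⟨f, hf, rfl⟩
    obtain ⟨g, hg, hgs, rfl⟩ := IsCc.exists_eq_ccL1 hf
    refine (tendsto_integrated_sub p.1.2 hξ hg hgs).congr fun i => ?_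
    rw [← trivChar_of_ccL1 hξ hg hgs]
    rfl

theorem tendsto_rep_sub (hξ : p.1.2.HasAlmostInvariant l ξ) (a : SymPF R) :
    Tendsto (fun i => rep p a (ξ i) - trivChar R a • ξ i) l (𝓝 0) := by
  rw [Metric.tendsto_nhds]
  intro ε hε
  filter_upwards [eventually_norm_rep_sub_lt hξ (isCompact_singleton (x := a)) hε] with i hi
  rw [dist_zero_right]
  exact hi a rfl

/-- The trivial character is multiplicative, because it is the asymptotic eigenvalue of `π(a)` on
the almost invariant vectors. -/
theorem trivChar_mul (hξ : p.1.2.HasAlmostInvariant l ξ) (a b : SymPF R) :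
    trivChar R (a * b) = trivChar R a * trivChar R b := by
  have h1 := tendsto_rep_sub hξ (a * b)
  have h2 := ((rep p a).continuous.tendsto 0).comp (tendsto_rep_sub hξ b)
  have h3 := (tendsto_rep_sub hξ a).const_smul (trivChar R b)
  rw [map_zero] at h2
  rw [smul_zero] at h3
  have h4 := ((h2.add h3).sub h1).norm
  simp only [add_zero, sub_zero, norm_zero] at h4
  have h5 : ∀ i, ‖trivChar R (a * b) - trivChar R a * trivChar R b‖
      = ‖((rep p a : p.1.1 → p.1.1) ∘ fun i => rep p b (ξ i) - trivChar R b • ξ i) i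
        + trivChar R b • (rep p a (ξ i) - trivChar R a • ξ i)
        - (rep p (a * b) (ξ i) - trivChar R (a * b) • ξ i)‖ := by
    intro i
    have : ((rep p a : p.1.1 → p.1.1) ∘ fun i => rep p b (ξ i) - trivChar R b • ξ i) i
        + trivChar R b • (rep p a (ξ i) - trivChar R a • ξ i)
        - (rep p (a * b) (ξ i) - trivChar R (a * b) • ξ i)
        = (trivChar R (a * b) - trivChar R a * trivChar R b) • ξ i := by
      rw [map_mul, Function.comp_apply, map_sub, map_smul]
      change _ - (rep p a (rep p b (ξ i)) - _) = _
      rw [smul_sub, smul_smul, sub_smul, mul_comm (trivChar R b)]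
      abel
    rw [this, norm_smul, hξ.norm_eq_one, mul_one]
  simp only [← h5] at h4
  exact sub_eq_zero.1 (norm_eq_zero.1 (tendsto_nhds_unique tendsto_const_nhds h4))

/-- The space of a representation with almost invariant vectors, as a bimodule with the given left
action and the trivial right action. -/
def trivBimodule (hξ : p.1.2.HasAlmostInvariant l ξ) : Bimodule (SymPF R) p.1.1 where
  left := rep p
  right :=
    { toFun := fun b => trivChar R b.unop • ContinuousLinearMap.id ℂ p.1.1
      map_smul' := fun c b => by simp [mul_smul]
      map_zero' := by simp
      map_add' := fun b c => by simp [add_smul]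
      map_mul' := fun b c => by
        rw [MulOpposite.unop_mul, trivChar_mul hξ]
        ext ζ
        exact (mul_smul _ _ ζ).trans (smul_comm _ _ ζ) }
  norm_left_le := norm_rep_le p
  norm_right_le b := by
    refine ContinuousLinearMap.opNorm_le_bound _ (norm_nonneg _) fun ζ => ?_
    change ‖trivChar R b.unop • ζ‖ ≤ _
    rw [norm_smul]
    exact mul_le_mul_of_nonneg_right (norm_trivChar_le hξ b.unop) (norm_nonneg _)
  commute a b := by
    ext ζ
    exact map_smul (rep p a) (trivChar R b.unop) ζ

theorem trivBimodule_left (hξ : p.1.2.HasAlmostInvariant l ξ) (a : SymPF R) :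
    (trivBimodule hξ).left a = rep p a := rfl

theorem trivBimodule_right (hξ : p.1.2.HasAlmostInvariant l ξ) (a : SymPF R) (ζ : p.1.1) :
    (trivBimodule hξ).right (MulOpposite.op a) ζ = trivChar R a • ζ := rfl

theorem isEssential_trivBimodule (hξ : p.1.2.HasAlmostInvariant l ξ) :
    (trivBimodule hξ).IsEssential := by
  refine Dense.mono Submodule.subset_span fun ζ => ?_
  rw [Metric.mem_closure_iff]
  intro ε hε
  have hU := (p.1.2.continuous_orbit ζ).continuousAt (x := 1)
    (Metric.closedBall_mem_nhds _ (half_pos hε))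
  obtain ⟨g, hg⟩ := exists_isBump hU
  refine ⟨_, ⟨of R (ccL1 g hg.continuous hg.hasCompactSupport),
    of R (ccL1 g hg.continuous hg.hasCompactSupport), ζ, rfl⟩, ?_⟩
  rw [trivBimodule_right, trivChar_of_ccL1 hξ, hg.integral_eq_one, one_smul, trivBimodule_left,
    rep_of, integrated_ccL1, dist_comm, dist_eq_norm]
  refine (hg.norm_integral_smul_sub_le (p.1.2.continuous_orbit ζ) fun s hs => ?_).trans_lt
    (half_lt_self hε)
  rw [← dist_eq_norm]
  simpa using hs

/-- There is an element of `F*_R(G)` on which the trivial character is `1`, also after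
translation. -/
theorem exists_trivChar_eq_one (hξ : p.1.2.HasAlmostInvariant l ξ) :
    ∃ e : SymPF R, trivChar R e = 1 ∧ ∀ s : G, trivChar R (leftShift s e) = 1 := by
  obtain ⟨g, hg⟩ := exists_isBump (G := G) univ_mem
  refine ⟨of R (ccL1 g hg.continuous hg.hasCompactSupport), ?_, fun s => ?_⟩
  · rw [trivChar_of_ccL1 hξ, hg.integral_eq_one]
  · rw [leftShift_of, trivChar_of_ccL1 hξ]
    exact (integral_mul_left_eq_self g s⁻¹).trans hg.integral_eq_one

theorem strictlyAlmostCentral_trivBimodule (hξ : p.1.2.HasAlmostInvariant l ξ)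
    {S : Set 𝓜(ℂ, SymPF R)} (hS : @IsCompact _ (strictTopology (SymPF R)) S) {ε : ℝ}
    (hε : 0 < ε) :
    ∀ᶠ i in l, ∀ x ∈ S, ‖(trivBimodule hξ).multLeft x (ξ i)
      - (trivBimodule hξ).multRight x (ξ i)‖ < ε := by
  have hess := isEssential_trivBimodule hξ
  obtain ⟨e, he, -⟩ := exists_trivChar_eq_one hξ
  have hcont : ∀ a : SymPF R, @Continuous _ _ (strictTopology (SymPF R)) _
      (fun x : 𝓜(ℂ, SymPF R) => x.fst a) := fun a => by
    let _ := strictTopology (SymPF R)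
    have h : Continuous fun (x : 𝓜(ℂ, SymPF R)) (a : SymPF R) => (x.fst a, x.snd a) :=
      continuous_induced_dom
    exact continuous_fst.comp ((continuous_apply a).comp h)
  have hQ : ∀ a, IsCompact ((fun x : 𝓜(ℂ, SymPF R) => x.fst a) '' S) := fun a =>
    @IsCompact.image _ _ (strictTopology (SymPF R)) _ _ _ hS (hcont a)
  -- A strictly compact set is pointwise bounded, hence norm bounded.
  obtain ⟨B, hB⟩ : ∃ B, ∀ x : S, ‖x.1.fst‖ ≤ B := by
    refine banach_steinhaus fun a => ?_
    obtain ⟨C, hC⟩ := (hQ a).isBounded.exists_norm_le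
    exact ⟨C, fun x => hC _ ⟨x.1, x.2, rfl⟩⟩
  have hmult : ∀ x ∈ S, ‖(trivBimodule hξ).multLeft x‖ ≤ |B| := fun x hx => by
    refine (Bimodule.norm_multLeft_le hess isApproximateUnit_bumpFilter
      eventually_norm_le_one x).trans ?_
    rw [mul_one]
    exact (hB ⟨x, hx⟩).trans (le_abs_self B)
  have hright : ∀ x ζ, (trivBimodule hξ).multRight x ζ = trivChar R (x.fst e) • ζ := by
    intro x ζ
    have h := Bimodule.multRight_apply hasBoundedApproximateUnit hess x e ζ
    rw [trivBimodule_right, he, one_smul, trivBimodule_right] at h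
    rw [h]
    have h2 := congrArg (trivChar R) (x.central e e)
    rw [trivChar_mul hξ, trivChar_mul hξ, he, one_mul, mul_one] at h2
    rw [h2]
  have hδ : 0 < ε / (2 * (|B| + 1)) := by positivity
  filter_upwards [eventually_norm_rep_sub_lt hξ (hQ e) (half_pos hε),
    eventually_norm_rep_sub_lt hξ (isCompact_singleton (x := e)) hδ] with i h1 h2 x hx
  have h3 := h2 e rfl
  rw [he, one_smul, norm_sub_rev] at h3
  have h4 := h1 _ ⟨x, hx, rfl⟩
  -- `x · ξᵢ` is compared with `x · (e · ξᵢ) = L(e) · ξᵢ`.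
  have key : (trivBimodule hξ).multLeft x (ξ i) - (trivBimodule hξ).multRight x (ξ i)
      = (trivBimodule hξ).multLeft x (ξ i - rep p e (ξ i))
        + (rep p (x.fst e) (ξ i) - trivChar R (x.fst e) • ξ i) := by
    have h5 := Bimodule.multLeft_apply hasBoundedApproximateUnit hess x e (ξ i)
    rw [trivBimodule_left, trivBimodule_left] at h5
    rw [map_sub, h5, hright]
    abel
  rw [key]
  have h6 : ‖(trivBimodule hξ).multLeft x (ξ i - rep p e (ξ i))‖ ≤ ε / 2 := by
    refine (((trivBimodule hξ).multLeft x).le_of_opNorm_le (hmult x hx) _).trans ?_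
    calc |B| * ‖ξ i - rep p e (ξ i)‖ ≤ (|B| + 1) * (ε / (2 * (|B| + 1))) := by
          gcongr
          linarith
      _ = ε / 2 := by field_simp
  calc _ ≤ ‖(trivBimodule hξ).multLeft x (ξ i - rep p e (ξ i))‖
        + ‖rep p (x.fst e) (ξ i) - trivChar R (x.fst e) • ξ i‖ := norm_add_le _ _
    _ < ε := by linarith

theorem isInvariant_of_isCentral (hξ : p.1.2.HasAlmostInvariant l ξ) {ζ : p.1.1}
    (hζ : (trivBimodule hξ).IsCentral ζ) : p.1.2.IsInvariant ζ := by
  obtain ⟨e, he, hes⟩ := exists_trivChar_eq_one hξ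
  have hrep : ∀ a, rep p a ζ = trivChar R a • ζ := hζ
  intro s
  have h := rep_leftShift p s e ζ
  rw [hrep, hrep, he, hes, one_smul] at h
  exact h.symm

end AlmostInvariant

end SymPF

end Character

/-! ### From the algebra to the group -/

theorem WeakPropertyT.groupWeakPropertyT {G : Type v} [Group G] [TopologicalSpace G]
    [IsTopologicalGroup G] [LocallyCompactSpace G] [T2Space G] [MeasurableSpace G] [BorelSpace G]
    {𝓔 : Set BanachSp.{u}} (h : WeakPropertyT (SymPseudofunctions G 𝓔) 𝓔) :
    GroupWeakPropertyT G 𝓔 := by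
  rintro E hE π ⟨I, _, _, _, ξ, hξ1, hξ⟩
  let p : Idx (RepClass (G := G) 𝓔) := ⟨⟨E, π⟩, .of hE⟩
  have H : p.1.2.HasAlmostInvariant atTop ξ :=
    ⟨hξ1, fun K hK ε hε => eventually_atTop.2 (hξ K hK ε hε)⟩
  -- The index set is lifted to the universe of the algebra.
  have hdir : IsDirectedOrder (ULift.{max v (u + 1)} I) := ⟨fun i j => by
    obtain ⟨k, hi, hj⟩ := exists_ge_ge i.down j.down
    exact ⟨⟨k⟩, hi, hj⟩⟩
  obtain ⟨ζ, hζ0, hζ⟩ := h.2 E hE (SymPF.trivBimodule H) (SymPF.isEssential_trivBimodule H)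
    ⟨ULift.{max v (u + 1)} I, inferInstance, hdir, inferInstance, fun i => ξ i.down,
      fun i => hξ1 i.down, fun S hS ε hε => by
        obtain ⟨i₀, hi₀⟩ := eventually_atTop.1
          (SymPF.strictlyAlmostCentral_trivBimodule H hS hε)
        exact ⟨⟨i₀⟩, fun i hi => hi₀ i.down hi⟩⟩
  exact ⟨ζ, hζ0, SymPF.isInvariant_of_isCentral H hζ⟩

end BanachT

end

theorem mainTheorem2 {G : Type v} [Group G] [TopologicalSpace G] [IsTopologicalGroup G]
    [LocallyCompactSpace G] [T2Space G] [MeasurableSpace G] [BorelSpace G]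
    (𝓔 : Set BanachT.BanachSp.{u}) :
    BanachT.GroupWeakPropertyT G 𝓔 ↔
      BanachT.WeakPropertyT (BanachT.SymPseudofunctions G 𝓔) 𝓔 := by
  exact ⟨fun h => h.weakPropertyT _, fun h => h.groupWeakPropertyT⟩
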